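/- **Banach–Lamperti theorem for partial isometries.** Let $\mathbb F\in\{\mathbb R,\mathbb C\}$, let $p\in[1,\infty]\setminus\{2\}$, and let $(\Omega,\Sigma,\mu)$ be a measure space with $\mu$ localizable, i.e. $\mu$ is semi-finite and the Boolean algebra $[\Sigma]$ of measurable sets modulo $\mu$-null sets is Dedekind complete. Write $L^p(\mu)=L^p(\mu,\mathbb F)$, write $B(L^p(\mu))$ for the bounded operators on it, and let $L_0(\mu)$ be the space of $\mathbb F$-valued measurable functions modulo a.e. equality. *Definitions.* A generalized inverse of $T$ is an element $T^*$ with $T=TT^*T$ and $T^*=T^*TT^*$. For $D\in\Sigma$ let $\Sigma_D=\{C\in\Sigma: C\subseteq D\}$. A partial set automorphism $\Phi$ is a map $\Phi:\Sigma_{D_{\Phi^*}}\to\Sigma_{D_\Phi}$, with $D_\Phi,D_{\Phi^*}\in\Sigma$, that descends to an isomorphism $[\Sigma_{D_{\Phi^*}}]\to[\Sigma_{D_\Phi}]$ of Boolean algebras modulo null sets; $\Phi^*:\Sigma_{D_\Phi}\to\Sigma_{D_{\Phi^*}}$ denotes a map inducing the inverse isomorphism. $T_\Phi:L_0(\mu)\to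 L_0(\mu)$ is the unique linear operator that preserves a.e. limits of sequences and satisfies $T_\Phi 1_C=1_{\Phi(C\cap D_{\Phi^*})}$ for $C\in\Sigma$. The set $\mathrm{SPIso}(L^p(\mu))$ of spatial partial isometries consists of the operators on $L^p(\mu)$ of the form $$\omega\Big(\frac{d\,\mu\circ\Phi^*}{d\,\mu|_{D_\Phi}}\Big)^{1/p}T_\Phi,$$ where $\Phi$ is a partial set automorphism and $\omega:D_\Phi\to\{z\in\mathbb F:|z|=1\}$ is measurable (with $1/\infty=0$). A multiplication operator on $L^p(\mu)$ is an operator $f\mapsto gf$ with $g\in L^\infty(\mu)$. An $L^p$-projection on a Banach space $E$ is an idempotent $P\in B(E)$ such that, for all $\xi\in E$, $\|\xi\|^p=\|P\xi\|^p+\|\xi-P\xi\|^p$ if $p<\infty$, and $\|\xi\|=\max\{\|P\xi\|,\|\xi-P\xi\|\}$ if $p=\infty$. An $L^p$-partial isometry on $E$ is a contraction $T\in B(E)$ that has a contractive generalized inverse $T^*\in B(E)$ such that $TT^*$ and $T^*T$ are $L^p$-projections. An MP-partial isometry in a unital complex Banach algebra $B$ is a contractive element $t$ that has a contractive generalized inverse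 $t^*$ such that $tt^*$ and $t^*t$ are hermitian, where $a\in B$ is hermitian if $\|e^{isa}\|=1$ for all $s\in\mathbb R$. *Theorem.* 1. An operator $T\in B(L^p(\mu))$ is a spatial partial isometry if and only if it is a contraction and has a contractive generalized inverse $T^*\in B(L^p(\mu))$ such that both $TT^*$ and $T^*T$ are multiplication operators. 2. $\mathrm{SPIso}(L^p(\mu))$ equals the set of $L^p$-partial isometries on $L^p(\mu)$, and this set is an inverse semigroup under composition: it is closed under composition and each of its elements has exactly one generalized inverse in it. 3. If $\mathbb F=\mathbb C$ and $\mu\neq0$, then $\mathrm{SPIso}(L^p(\mu))$ also equals the set of MP-partial isometries in $B(L^p(\mu))$. -/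

import Mathlib

open MeasureTheory Filter Topology
open scoped ENNReal NNReal

noncomputable section

namespace SpatialPI

/-! ### Localizable measures -/

/-- `μ` is localizable: it is semi-finite (the measure of a measurable set is the supremum of the
measures of its measurable subsets of finite measure), and the Boolean algebra of measurable sets
modulo null sets is Dedekind complete, i.e. every family of measurable sets has an essential
supremum. -/
structure IsLocalizable {Ω : Type*} [MeasurableSpace Ω] (μ : Measure Ω) : Prop where
  semifinite : ∀ A : Set Ω, MeasurableSet A →
    μ A = ⨆ (B : Set Ω) (_ : MeasurableSet B) (_ : B ⊆ A) (_ : μ B < ∞), μ B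
  exists_essSup : ∀ F : Set (Set Ω), (∀ A ∈ F, MeasurableSet A) →
    ∃ S : Set Ω, MeasurableSet S ∧ (∀ A ∈ F, μ (A \ S) = 0) ∧
      ∀ S' : Set Ω, MeasurableSet S' → (∀ A ∈ F, μ (A \ S') = 0) → μ (S \ S') = 0

/-! ### Generalized inverses and inverse semigroups -/

/-- `s` is a generalized inverse of `t`. -/
def IsGenInverse {M : Type*} [Mul M] (t s : M) : Prop :=
  t = t * s * t ∧ s = s * t * s

/-- The subset `S` of a semigroup is a subsemigroup which, as a semigroup in its own right, is an
inverse semigroup: every element of `S` has exactly one generalized inverse in `S`. -/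
def IsInverseSubsemigroup {M : Type*} [Semigroup M] (S : Set M) : Prop :=
  (∀ s ∈ S, ∀ t ∈ S, s * t ∈ S) ∧ ∀ t ∈ S, ∃! s, s ∈ S ∧ IsGenInverse t s

/-! ### `L^p`-partial isometries on a normed space, MP-partial isometries in a Banach algebra -/

/-- `L^p`-projections on a normed space. -/
def IsLpProjection {𝕜 E : Type*} [RCLike 𝕜] [NormedAddCommGroup E] [NormedSpace 𝕜 E]
    (p : ℝ≥0∞) (P : E →L[𝕜] E) : Prop :=
  P * P = P ∧
    (p ≠ ∞ → ∀ ξ : E, ‖ξ‖ ^ p.toReal = ‖P ξ‖ ^ p.toReal + ‖ξ - P ξ‖ ^ p.toReal) ∧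
    (p = ∞ → ∀ ξ : E, ‖ξ‖ = max ‖P ξ‖ ‖ξ - P ξ‖)

/-- The set of `L^p`-partial isometries on `E`. -/
def LpPIso (𝕜 E : Type*) [RCLike 𝕜] [NormedAddCommGroup E] [NormedSpace 𝕜 E]
    (p : ℝ≥0∞) : Set (E →L[𝕜] E) :=
  {T | ‖T‖ ≤ 1 ∧ ∃ S : E →L[𝕜] E, ‖S‖ ≤ 1 ∧ IsGenInverse T S ∧
    IsLpProjection p (T * S) ∧ IsLpProjection p (S * T)}

/-- Hermitian elements of a complex unital Banach algebra. -/
def IsHermitianElem {B : Type*} [NormedRing B] [NormedAlgebra ℂ B] (a : B) : Prop :=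
  ∀ t : ℝ, ‖NormedSpace.exp ((Complex.I * (t : ℂ)) • a)‖ = 1

/-- The set of MP-partial isometries: contractive elements that admit a contractive
Moore--Penrose generalized inverse. -/
def MPPIso (B : Type*) [NormedRing B] [NormedAlgebra ℂ B] : Set B :=
  {t | ‖t‖ ≤ 1 ∧ ∃ s : B, ‖s‖ ≤ 1 ∧ IsGenInverse t s ∧
    IsHermitianElem (t * s) ∧ IsHermitianElem (s * t)}

/-! ### Spatial partial isometries -/

section Spatial

variable {Ω : Type*} [MeasurableSpace Ω]

/-- A partial set automorphism `Φ` of `(Ω, Σ, μ)`: a map from the measurable subsets of `dom` to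
the measurable subsets of `cod` that descends to an isomorphism of the Boolean algebras of
measurable sets modulo null sets, together with a choice of representatives `invFun` of the
inverse isomorphism `Φ*`. The values of `toFun` and `invFun` on other sets play no role. -/
structure PartialSetAut (μ : Measure Ω) where
  /-- the domain `D_{Φ*}` -/
  dom : Set Ω
  /-- the codomain `D_Φ` -/
  cod : Set Ω
  measurableSet_dom : MeasurableSet dom
  measurableSet_cod : MeasurableSet cod
  /-- `Φ` -/
  toFun : Set Ω → Set Ω
  /-- `Φ*` -/
  invFun : Set Ω → Set Ω
  toFun_mem : ∀ C, MeasurableSet C → C ⊆ dom → MeasurableSet (toFun C) ∧ toFun C ⊆ cod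
  invFun_mem : ∀ C, MeasurableSet C → C ⊆ cod → MeasurableSet (invFun C) ∧ invFun C ⊆ dom
  null_diff_iff : ∀ C C', MeasurableSet C → C ⊆ dom → MeasurableSet C' → C' ⊆ dom →
    (μ (C \ C') = 0 ↔ μ (toFun C \ toFun C') = 0)
  toFun_invFun : ∀ C, MeasurableSet C → C ⊆ cod → toFun (invFun C) =ᵐ[μ] C

/-- `V : L_0(μ) → L_0(μ)` is the composition operator `T_Φ`: the linear operator with
`T_Φ 1_C = 1_{Φ(C ∩ dom)}` that preserves almost everywhere limits of sequences. -/
structure IsCompositionOp {𝕜 : Type*} [RCLike 𝕜] {μ : Measure Ω} (Φ : PartialSetAut μ)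
    (V : (Ω →ₘ[μ] 𝕜) →ₗ[𝕜] (Ω →ₘ[μ] 𝕜)) : Prop where
  map_indicator : ∀ C : Set Ω, MeasurableSet C → ∀ f : Ω →ₘ[μ] 𝕜,
    f =ᵐ[μ] C.indicator (fun _ => (1 : 𝕜)) →
      V f =ᵐ[μ] (Φ.toFun (C ∩ Φ.dom)).indicator (fun _ => (1 : 𝕜))
  map_lim : ∀ (f : ℕ → Ω →ₘ[μ] 𝕜) (g : Ω →ₘ[μ] 𝕜),
    (∀ᵐ x ∂μ, Tendsto (fun n => f n x) atTop (𝓝 (g x))) →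
      ∀ᵐ x ∂μ, Tendsto (fun n => V (f n) x) atTop (𝓝 (V g x))

/-- `h` is the Radon--Nikodym derivative of `μ ∘ Φ*` with respect to `μ` on `D_Φ`, extended by
zero. -/
structure IsRNDeriv {μ : Measure Ω} (Φ : PartialSetAut μ) (h : Ω → ℝ≥0) : Prop where
  measurable : Measurable h
  eq_zero : ∀ x, x ∉ Φ.cod → h x = 0
  lintegral_eq : ∀ C, MeasurableSet C → C ⊆ Φ.cod →
    μ (Φ.invFun C) = ∫⁻ x in C, (h x : ℝ≥0∞) ∂μ

/-- The set of spatial partial isometries on `L^p(μ)`: the operators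
`ω (d(μ ∘ Φ*) / dμ|_{D_Φ})^{1/p} T_Φ`, with `Φ` a partial set automorphism and `ω` a measurable
function of modulus one on `D_Φ`. For `p = ∞` the exponent `1 / p.toReal` is `0`, as it should. -/
def SPIso (𝕜 : Type*) [RCLike 𝕜] (p : ℝ≥0∞) [Fact (1 ≤ p)] (μ : Measure Ω) :
    Set (Lp 𝕜 p μ →L[𝕜] Lp 𝕜 p μ) :=
  {T | ∃ (Φ : PartialSetAut μ) (V : (Ω →ₘ[μ] 𝕜) →ₗ[𝕜] (Ω →ₘ[μ] 𝕜)) (h : Ω → ℝ≥0) (ω : Ω → 𝕜),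
    IsCompositionOp Φ V ∧ IsRNDeriv Φ h ∧ Measurable ω ∧ (∀ x ∈ Φ.cod, ‖ω x‖ = 1) ∧
    ∀ f : Lp 𝕜 p μ, T f =ᵐ[μ] fun x =>
      ω x * (((h x : ℝ) ^ (1 / p.toReal) : ℝ) : 𝕜) * V (f : Ω →ₘ[μ] 𝕜) x}

/-- `P` is the operator of multiplication by some function in `L^∞(μ)`. -/
def IsMultiplicationOp {𝕜 : Type*} [RCLike 𝕜] {p : ℝ≥0∞} [Fact (1 ≤ p)] {μ : Measure Ω}
    (P : Lp 𝕜 p μ →L[𝕜] Lp 𝕜 p μ) : Prop :=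
  ∃ g : Lp 𝕜 ∞ μ, ∀ f : Lp 𝕜 p μ, P f =ᵐ[μ] fun x => g x * f x

end Spatial

end SpatialPI

end

/-!
For `p ≠ 2` every `L^p`-projection `P` of `L^p(μ)` is multiplication by an indicator function: for
`p < ∞` the equality case of Clarkson's inequality forces `P f` and `g - P g` to have disjoint
supports, and for `p = ∞` an argument with the maximum norm and functions of modulus one gives the
same conclusion.

Let `T` be a contraction with a contractive generalized inverse `S` such that `TS` and `ST` are
multiplications by indicator functions. Conjugation by `T` maps the indicator multiplications below
`ST` to `L^p`-projections, hence to indicator multiplications, and so defines a partial set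
automorphism `Φ`. Localizability provides the Radon–Nikodym derivative `d(μ ∘ Φ*)/dμ` and with it
the canonical isometry `U` of `Φ`. The operator `T U*` commutes with all indicator multiplications;
it is therefore multiplication by a function, of modulus one on `D_Φ` because `T U*` and `U S` are
contractions inverse to each other there, and `T = (T U*) U` is spatial. Idempotent multiplications
commute, and this makes generalized inverses unique and the set of such `T` closed under
composition.

In the complex case, a hermitian idempotent `e` yields invertible isometries `1 + (c - 1) e` for
`|c| = 1`. They conjugate indicator multiplications to indicator multiplications, and comparing
`c = -1` with `c = i` shows that `e` commutes with all of these, so `e` is a multiplication.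
-/

noncomputable section

namespace SpatialPI

/-! ### The ring of measurable functions modulo null functions -/

section Ring

variable {Ω : Type*} [MeasurableSpace Ω] {μ : Measure Ω}

instance instCommRingAEEqFun {R : Type*} [TopologicalSpace R] [CommRing R] [IsTopologicalRing R] :
    CommRing (Ω →ₘ[μ] R) :=
  { (inferInstance : AddCommGroup (Ω →ₘ[μ] R)), (inferInstance : CommMonoid (Ω →ₘ[μ] R)) with
    left_distrib := fun f g h ↦ AEEqFun.induction_on₃ f g h fun _ _ _ _ _ _ ↦ by
      simp only [AEEqFun.mk_add_mk, AEEqFun.mk_mul_mk, mul_add]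
    right_distrib := fun f g h ↦ AEEqFun.induction_on₃ f g h fun _ _ _ _ _ _ ↦ by
      simp only [AEEqFun.mk_add_mk, AEEqFun.mk_mul_mk, add_mul]
    zero_mul := fun f ↦ AEEqFun.induction_on f fun _ _ ↦ by
      simp only [AEEqFun.zero_def, AEEqFun.mk_mul_mk, Pi.mul_def, zero_mul]
    mul_zero := fun f ↦ AEEqFun.induction_on f fun _ _ ↦ by
      simp only [AEEqFun.zero_def, AEEqFun.mk_mul_mk, Pi.mul_def, mul_zero] }

instance instSMulCommClassAEEqFun {𝕜 : Type*} [NormedField 𝕜] :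
    SMulCommClass 𝕜 (Ω →ₘ[μ] 𝕜) (Ω →ₘ[μ] 𝕜) where
  smul_comm c f g := AEEqFun.induction_on₂ f g fun _ _ _ _ ↦ by
    simp only [smul_eq_mul, AEEqFun.smul_mk, AEEqFun.mk_mul_mk, mul_smul_comm]

variable {𝕜 : Type*} [RCLike 𝕜]

theorem mul_eq_zero_iff_ae {f g : Ω →ₘ[μ] 𝕜} : f * g = 0 ↔ ∀ᵐ x ∂μ, f x = 0 ∨ g x = 0 := by
  rw [AEEqFun.ext_iff]
  refine eventually_congr ?_
  filter_upwards [AEEqFun.coeFn_mul f g, AEEqFun.coeFn_zero (μ := μ) (β := 𝕜)] with x hmul hzero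
  rw [hmul, hzero, Pi.mul_apply, Pi.zero_apply, mul_eq_zero]

open Classical in
/-- The class in `L₀(μ)` of the indicator function of a measurable set `A`. It is `0` by convention
if `A` is not measurable, which spares its arguments a measurability proof. -/
def chi (μ : Measure Ω) (𝕜 : Type*) [RCLike 𝕜] (A : Set Ω) : Ω →ₘ[μ] 𝕜 :=
  if h : MeasurableSet A then
    AEEqFun.mk (A.indicator fun _ ↦ 1) (aestronglyMeasurable_const.indicator h)
  else 0

theorem coeFn_chi {A : Set Ω} (hA : MeasurableSet A) :
    chi μ 𝕜 A =ᵐ[μ] A.indicator fun _ ↦ (1 : 𝕜) := by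
  rw [chi, dif_pos hA]
  exact AEEqFun.coeFn_mk _ _

theorem norm_chi_le (A : Set Ω) : ∀ᵐ x ∂μ, ‖chi μ 𝕜 A x‖ ≤ 1 := by
  by_cases hA : MeasurableSet A
  · filter_upwards [coeFn_chi (μ := μ) (𝕜 := 𝕜) hA] with x hx
    rw [hx]
    exact (norm_indicator_le_norm_self _ x).trans_eq norm_one
  · filter_upwards [AEEqFun.coeFn_zero (μ := μ) (β := 𝕜)] with x hx
    simp [chi, hA, hx]

theorem eq_chi_iff {A : Set Ω} (hA : MeasurableSet A) {f : Ω →ₘ[μ] 𝕜} :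
    f = chi μ 𝕜 A ↔ f =ᵐ[μ] A.indicator fun _ ↦ (1 : 𝕜) :=
  ⟨fun h ↦ h ▸ coeFn_chi hA, fun h ↦ AEEqFun.ext (h.trans (coeFn_chi hA).symm)⟩

theorem coeFn_chi_mul {A : Set Ω} (hA : MeasurableSet A) (f : Ω →ₘ[μ] 𝕜) :
    (chi μ 𝕜 A * f : Ω →ₘ[μ] 𝕜) =ᵐ[μ] A.indicator f := by
  filter_upwards [coeFn_chi (μ := μ) (𝕜 := 𝕜) hA, AEEqFun.coeFn_mul (chi μ 𝕜 A) f] with x hchi hmul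
  rw [hmul, Pi.mul_apply, hchi, ← Set.indicator_mul_left]
  simp only [one_mul]

theorem chi_mul_eq_self_iff {A : Set Ω} (hA : MeasurableSet A) {f : Ω →ₘ[μ] 𝕜} :
    chi μ 𝕜 A * f = f ↔ ∀ᵐ x ∂μ, x ∉ A → f x = 0 := by
  rw [AEEqFun.ext_iff]
  refine eventually_congr ?_
  filter_upwards [coeFn_chi_mul hA f] with x hx
  rw [hx, Set.indicator_apply_eq_self]

theorem chi_mul_eq_zero_iff {A : Set Ω} (hA : MeasurableSet A) {f : Ω →ₘ[μ] 𝕜} :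
    chi μ 𝕜 A * f = 0 ↔ ∀ᵐ x ∂μ, x ∈ A → f x = 0 := by
  rw [AEEqFun.ext_iff]
  refine eventually_congr ?_
  filter_upwards [coeFn_chi_mul hA f, AEEqFun.coeFn_zero (μ := μ) (β := 𝕜)] with x hx hzero
  rw [hx, hzero, Pi.zero_apply, Set.indicator_apply_eq_zero]

theorem chi_mul_chi {A B : Set Ω} (hA : MeasurableSet A) (hB : MeasurableSet B) :
    chi μ 𝕜 A * chi μ 𝕜 B = chi μ 𝕜 (A ∩ B) := by
  rw [eq_chi_iff (hA.inter hB)]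
  filter_upwards [coeFn_chi_mul hA (chi μ 𝕜 B), coeFn_chi (μ := μ) (𝕜 := 𝕜) hB] with x hmul hchi
  rw [hmul, ← Set.indicator_indicator]
  exact Set.indicator_eq_indicator Iff.rfl hchi

theorem chi_congr {A B : Set Ω} (hA : MeasurableSet A) (hB : MeasurableSet B) (h : A =ᵐ[μ] B) :
    chi μ 𝕜 A = chi μ 𝕜 B :=
  (eq_chi_iff hB).2 ((coeFn_chi hA).trans (indicator_ae_eq_of_ae_eq_set h))

theorem exists_mul_eq_chi {A : Set Ω} (hA : MeasurableSet A) {f : Ω →ₘ[μ] 𝕜}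
    (hf : ∀ᵐ x ∂μ, x ∈ A → f x ≠ 0) : ∃ g, f * g = chi μ 𝕜 A := by
  have hmeas : Measurable (A.indicator (f : Ω → 𝕜)⁻¹) := f.measurable.inv.indicator hA
  let g : Ω →ₘ[μ] 𝕜 := AEEqFun.mk _ hmeas.aestronglyMeasurable
  refine ⟨g, (eq_chi_iff hA).2 ?_⟩
  filter_upwards [AEEqFun.coeFn_mul f g, AEEqFun.coeFn_mk _ (hmeas.aestronglyMeasurable (μ := μ)),
    hf] with x hmul hg hx
  rw [hmul, Pi.mul_apply, hg]
  by_cases hxA : x ∈ A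
  · rw [Set.indicator_of_mem hxA, Set.indicator_of_mem hxA, Pi.inv_apply, mul_inv_cancel₀ (hx hxA)]
  · rw [Set.indicator_of_notMem hxA, Set.indicator_of_notMem hxA, mul_zero]

theorem chi_univ : chi μ 𝕜 Set.univ = 1 :=
  ((eq_chi_iff .univ).2 (by rw [Set.indicator_univ]; exact AEEqFun.coeFn_one)).symm

theorem chi_compl {A : Set Ω} (hA : MeasurableSet A) : chi μ 𝕜 Aᶜ = 1 - chi μ 𝕜 A := by
  symm
  rw [eq_chi_iff hA.compl, ← chi_univ]
  filter_upwards [coeFn_chi (μ := μ) (𝕜 := 𝕜) .univ, AEEqFun.coeFn_sub (chi μ 𝕜 .univ) (chi μ 𝕜 A),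
    coeFn_chi (μ := μ) (𝕜 := 𝕜) hA] with x huniv hsub hchi
  rw [hsub, Pi.sub_apply, huniv, hchi, Set.indicator_univ, Set.indicator_compl, Pi.sub_apply]

theorem chi_mul_self {A : Set Ω} (hA : MeasurableSet A) :
    chi μ 𝕜 A * chi μ 𝕜 A = chi μ 𝕜 A := by
  rw [chi_mul_chi hA hA, Set.inter_self]

theorem chi_mul_chi_of_subset {A B : Set Ω} (hA : MeasurableSet A) (hB : MeasurableSet B)
    (h : A ⊆ B) : chi μ 𝕜 B * chi μ 𝕜 A = chi μ 𝕜 A := by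
  rw [chi_mul_chi hB hA, Set.inter_eq_right.2 h]

/-- The support of the representative that `AEEqFun.cast` chooses for `f`; it is a measurable set,
determined by `f` up to null sets. -/
def suppSet (f : Ω →ₘ[μ] 𝕜) : Set Ω := {x | f x ≠ 0}

theorem measurableSet_suppSet (f : Ω →ₘ[μ] 𝕜) : MeasurableSet (suppSet f) :=
  (f.measurable (measurableSet_singleton 0)).compl

theorem measure_suppSet_diff_eq_zero_iff {A : Set Ω} (hA : MeasurableSet A) {f : Ω →ₘ[μ] 𝕜} :
    μ (suppSet f \ A) = 0 ↔ chi μ 𝕜 A * f = f := by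
  rw [chi_mul_eq_self_iff hA, measure_eq_zero_iff_ae_notMem]
  simp only [suppSet, Set.mem_sdiff, Set.mem_ofPred_eq, not_and, not_not, not_imp_comm (b := _ ∈ A)]

theorem chi_suppSet_mul (f : Ω →ₘ[μ] 𝕜) : chi μ 𝕜 (suppSet f) * f = f :=
  (measure_suppSet_diff_eq_zero_iff (measurableSet_suppSet f)).1 (by
    rw [sdiff_self, Set.bot_eq_empty, measure_empty])

end Ring

/-! ### Multiplication operators -/

section Multiplication

variable {Ω : Type*} [MeasurableSpace Ω] {μ : Measure Ω} {𝕜 : Type*} [RCLike 𝕜]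

theorem ae_norm_le_norm (f : Lp 𝕜 ∞ μ) : ∀ᵐ x ∂μ, ‖f x‖ ≤ ‖f‖ := by
  rw [Lp.norm_def, toReal_eLpNorm (Lp.aestronglyMeasurable f)]
  exact ae_le_lpNorm_exponent_top (Lp.memLp f)

theorem mem_Lp_top_of_ae_norm_le {k : Ω →ₘ[μ] 𝕜} {c : ℝ} (hk : ∀ᵐ x ∂μ, ‖k x‖ ≤ c) :
    k ∈ Lp 𝕜 ∞ μ :=
  Lp.mem_Lp_iff_memLp.2 (memLp_top_of_bound k.aestronglyMeasurable c hk)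

theorem norm_le_of_ae_norm_le {f : Lp 𝕜 ∞ μ} {c : ℝ} (hc : 0 ≤ c) (hf : ∀ᵐ x ∂μ, ‖f x‖ ≤ c) :
    ‖f‖ ≤ c := by
  rw [Lp.norm_def, eLpNorm_exponent_top]
  exact ENNReal.toReal_le_of_le_ofReal hc (eLpNormEssSup_le_of_ae_bound hf)

variable {p : ℝ≥0∞} [Fact (1 ≤ p)]

/-- The operator `mulOp p g` of multiplication by `g ∈ L^∞(μ)` on `L^p(μ)`, as a bounded linear
function of `g`. -/
def mulOp (p : ℝ≥0∞) [Fact (1 ≤ p)] : Lp 𝕜 ∞ μ →L[𝕜] Lp 𝕜 p μ →L[𝕜] Lp 𝕜 p μ :=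
  (ContinuousLinearMap.mul 𝕜 𝕜).holderL μ ∞ p p

theorem coe_mulOp (g : Lp 𝕜 ∞ μ) (f : Lp 𝕜 p μ) : (mulOp p g f : Ω →ₘ[μ] 𝕜) = g * f :=
  AEEqFun.ext (((ContinuousLinearMap.mul 𝕜 𝕜).coeFn_holder g f).trans (AEEqFun.coeFn_mul _ _).symm)

theorem isMultiplicationOp_iff {P : Lp 𝕜 p μ →L[𝕜] Lp 𝕜 p μ} :
    IsMultiplicationOp P ↔ ∃ g : Lp 𝕜 ∞ μ, P = mulOp p g := by
  refine exists_congr fun g ↦ ?_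
  rw [ContinuousLinearMap.ext_iff]
  refine forall_congr' fun f ↦ ?_
  rw [Subtype.ext_iff, coe_mulOp, AEEqFun.ext_iff]
  exact ⟨fun h ↦ h.trans (AEEqFun.coeFn_mul _ _).symm, fun h ↦ h.trans (AEEqFun.coeFn_mul _ _)⟩

theorem IsMultiplicationOp.commute {P Q : Lp 𝕜 p μ →L[𝕜] Lp 𝕜 p μ}
    (hP : IsMultiplicationOp P) (hQ : IsMultiplicationOp Q) : Commute P Q := by
  obtain ⟨g, rfl⟩ := isMultiplicationOp_iff.1 hP
  obtain ⟨k, rfl⟩ := isMultiplicationOp_iff.1 hQ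
  refine ContinuousLinearMap.ext fun f ↦ Subtype.ext ?_
  simp only [mul_apply_eq_comp, coe_mulOp]
  exact mul_left_comm _ _ _

/-- The class `chi μ 𝕜 D` of the indicator function of `D` as an element of `L^∞(μ)`. -/
def chiTop (μ : Measure Ω) (𝕜 : Type*) [RCLike 𝕜] (D : Set Ω) : Lp 𝕜 ∞ μ :=
  ⟨chi μ 𝕜 D, mem_Lp_top_of_ae_norm_le (norm_chi_le D)⟩

theorem coeFn_chiTop {D : Set Ω} (hD : MeasurableSet D) :
    chiTop μ 𝕜 D =ᵐ[μ] D.indicator fun _ ↦ (1 : 𝕜) :=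
  coeFn_chi hD

theorem norm_chiTop_le (D : Set Ω) : ‖chiTop μ 𝕜 D‖ ≤ 1 :=
  norm_le_of_ae_norm_le zero_le_one (norm_chi_le D)

/-- The operator of multiplication by the indicator function of `D` on `L^p(μ)`. -/
def chiOp (p : ℝ≥0∞) [Fact (1 ≤ p)] (μ : Measure Ω) (𝕜 : Type*) [RCLike 𝕜] (D : Set Ω) :
    Lp 𝕜 p μ →L[𝕜] Lp 𝕜 p μ :=
  mulOp p (chiTop μ 𝕜 D)

theorem coe_chiOp (D : Set Ω) (f : Lp 𝕜 p μ) : (chiOp p μ 𝕜 D f : Ω →ₘ[μ] 𝕜) = chi μ 𝕜 D * f :=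
  coe_mulOp _ f

theorem chiOp_mul_chiOp {A B : Set Ω} (hA : MeasurableSet A) (hB : MeasurableSet B) :
    chiOp p μ 𝕜 A * chiOp p μ 𝕜 B = chiOp p μ 𝕜 (A ∩ B) := by
  refine ContinuousLinearMap.ext fun f ↦ Subtype.ext ?_
  simp only [mul_apply_eq_comp, coe_chiOp]
  rw [← mul_assoc, chi_mul_chi hA hB]

theorem isIdempotentElem_chiOp {D : Set Ω} (hD : MeasurableSet D) :
    IsIdempotentElem (chiOp p μ 𝕜 D) := by
  rw [IsIdempotentElem, chiOp_mul_chiOp hD hD, Set.inter_self]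

theorem chiOp_univ : chiOp p μ 𝕜 .univ = 1 :=
  ContinuousLinearMap.ext fun f ↦ Subtype.ext <| by
    rw [coe_chiOp, chi_univ, one_mul, one_apply_eq_self]

theorem chiOp_congr {A B : Set Ω} (hA : MeasurableSet A) (hB : MeasurableSet B) (h : A =ᵐ[μ] B) :
    chiOp p μ 𝕜 A = chiOp p μ 𝕜 B := by
  refine ContinuousLinearMap.ext fun f ↦ Subtype.ext ?_
  rw [coe_chiOp, coe_chiOp, chi_congr hA hB h]

theorem isMultiplicationOp_chiOp (D : Set Ω) : IsMultiplicationOp (chiOp p μ 𝕜 D) :=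
  isMultiplicationOp_iff.2 ⟨_, rfl⟩

theorem IsMultiplicationOp.exists_eq_chiOp {P : Lp 𝕜 p μ →L[𝕜] Lp 𝕜 p μ}
    (hP : IsMultiplicationOp P) (h : IsIdempotentElem P) :
    ∃ D : Set Ω, MeasurableSet D ∧ P = chiOp p μ 𝕜 D := by
  obtain ⟨g, rfl⟩ := isMultiplicationOp_iff.1 hP
  set k := (g : Ω →ₘ[μ] 𝕜)
  refine ⟨suppSet k, measurableSet_suppSet k, ContinuousLinearMap.ext fun f ↦ Subtype.ext ?_⟩
  have hidem : k * (k * f) = k * f := by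
    simpa only [mul_apply_eq_comp, coe_mulOp] using
      congrArg Subtype.val (DFunLike.congr_fun h f)
  rw [coe_chiOp, coe_mulOp]
  have hzero : k * (chi μ 𝕜 (suppSet k) * f - k * f) = 0 := by
    rw [mul_sub, hidem, ← mul_assoc, mul_comm k, chi_suppSet_mul, sub_self]
  have hsupp : chi μ 𝕜 (suppSet k) * (chi μ 𝕜 (suppSet k) * f - k * f) = 0 := by
    rw [chi_mul_eq_zero_iff (measurableSet_suppSet k)]
    filter_upwards [mul_eq_zero_iff_ae.1 hzero] with x hx hmem
    exact hx.resolve_left hmem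
  rw [mul_sub, ← mul_assoc, ← mul_assoc, chi_mul_self (measurableSet_suppSet k),
    chi_suppSet_mul] at hsupp
  exact (sub_eq_zero.1 hsupp).symm

end Multiplication

/-! ### Partial set automorphisms -/

namespace PartialSetAut

variable {Ω : Type*} [MeasurableSpace Ω] {μ : Measure Ω} (Φ : PartialSetAut μ)

theorem measurableSet_toFun {C : Set Ω} (hC : MeasurableSet C) (h : C ⊆ Φ.dom) :
    MeasurableSet (Φ.toFun C) :=
  (Φ.toFun_mem C hC h).1

theorem toFun_subset {C : Set Ω} (hC : MeasurableSet C) (h : C ⊆ Φ.dom) : Φ.toFun C ⊆ Φ.cod :=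
  (Φ.toFun_mem C hC h).2

theorem toFun_le_toFun_iff {C C' : Set Ω} (hC : MeasurableSet C) (h : C ⊆ Φ.dom)
    (hC' : MeasurableSet C') (h' : C' ⊆ Φ.dom) :
    Φ.toFun C ≤ᵐ[μ] Φ.toFun C' ↔ C ≤ᵐ[μ] C' := by
  rw [ae_le_set, ae_le_set, Φ.null_diff_iff C C' hC h hC' h']

theorem toFun_congr {C C' : Set Ω} (hC : MeasurableSet C) (h : C ⊆ Φ.dom)
    (hC' : MeasurableSet C') (h' : C' ⊆ Φ.dom) (hCC' : C =ᵐ[μ] C') :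
    Φ.toFun C =ᵐ[μ] Φ.toFun C' :=
  ((Φ.toFun_le_toFun_iff hC h hC' h').2 hCC'.le).antisymm
    ((Φ.toFun_le_toFun_iff hC' h' hC h).2 hCC'.symm.le)

theorem invFun_toFun {C : Set Ω} (hC : MeasurableSet C) (h : C ⊆ Φ.dom) :
    Φ.invFun (Φ.toFun C) =ᵐ[μ] C := by
  obtain ⟨hΦC, hΦC'⟩ := Φ.toFun_mem C hC h
  obtain ⟨hD, hD'⟩ := Φ.invFun_mem _ hΦC hΦC'
  have hΦD := Φ.toFun_invFun _ hΦC hΦC'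
  exact ((Φ.toFun_le_toFun_iff hD hD' hC h).1 hΦD.le).antisymm
    ((Φ.toFun_le_toFun_iff hC h hD hD').1 hΦD.symm.le)

/-- The inverse partial set automorphism `Φ*`. -/
def symm : PartialSetAut μ where
  dom := Φ.cod
  cod := Φ.dom
  measurableSet_dom := Φ.measurableSet_cod
  measurableSet_cod := Φ.measurableSet_dom
  toFun := Φ.invFun
  invFun := Φ.toFun
  toFun_mem := Φ.invFun_mem
  invFun_mem := Φ.toFun_mem
  null_diff_iff C C' hC h hC' h' := by
    obtain ⟨hD, hD'⟩ := Φ.invFun_mem C hC h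
    obtain ⟨hE, hE'⟩ := Φ.invFun_mem C' hC' h'
    rw [Φ.null_diff_iff _ _ hD hD' hE hE',
      measure_congr ((Φ.toFun_invFun C hC h).diff (Φ.toFun_invFun C' hC' h'))]
  toFun_invFun _ hC h := Φ.invFun_toFun hC h

@[simp] theorem symm_dom : Φ.symm.dom = Φ.cod := rfl
@[simp] theorem symm_cod : Φ.symm.cod = Φ.dom := rfl
@[simp] theorem symm_toFun : Φ.symm.toFun = Φ.invFun := rfl

theorem toFun_le_iff_le_invFun {C B : Set Ω} (hC : MeasurableSet C) (h : C ⊆ Φ.dom)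
    (hB : MeasurableSet B) (h' : B ⊆ Φ.cod) :
    Φ.toFun C ≤ᵐ[μ] B ↔ C ≤ᵐ[μ] Φ.invFun B := by
  obtain ⟨hD, hD'⟩ := Φ.invFun_mem B hB h'
  rw [← Φ.toFun_le_toFun_iff hC h hD hD']
  have hB := Φ.toFun_invFun B hB h'
  exact ⟨fun hle ↦ hle.trans hB.symm.le, fun hle ↦ hle.trans hB.le⟩

theorem le_toFun_iff_invFun_le {C B : Set Ω} (hC : MeasurableSet C) (h : C ⊆ Φ.dom)
    (hB : MeasurableSet B) (h' : B ⊆ Φ.cod) :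
    B ≤ᵐ[μ] Φ.toFun C ↔ Φ.invFun B ≤ᵐ[μ] C :=
  (Φ.symm.toFun_le_iff_le_invFun hB h' hC h).symm

theorem toFun_dom : Φ.toFun Φ.dom =ᵐ[μ] Φ.cod := by
  have hdom := Φ.measurableSet_dom
  refine (Φ.toFun_subset hdom le_rfl).eventuallyLE.antisymm ?_
  rw [Φ.le_toFun_iff_invFun_le hdom le_rfl Φ.measurableSet_cod le_rfl]
  exact (Φ.symm.toFun_subset Φ.measurableSet_cod le_rfl).eventuallyLE

theorem toFun_null {C : Set Ω} (hC : MeasurableSet C) (h : C ⊆ Φ.dom) (h0 : μ C = 0) :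
    μ (Φ.toFun C) = 0 := by
  have hle : Φ.toFun C ≤ᵐ[μ] (∅ : Set Ω) :=
    (Φ.toFun_le_iff_le_invFun hC h .empty (Set.empty_subset _)).2
      (ae_le_set.2 (measure_mono_null Set.sdiff_subset h0))
  simpa only [Set.sdiff_empty] using ae_le_set.1 hle

theorem toFun_null_iff {C : Set Ω} (hC : MeasurableSet C) (h : C ⊆ Φ.dom) :
    μ (Φ.toFun C) = 0 ↔ μ C = 0 := by
  refine ⟨fun h0 ↦ ?_, Φ.toFun_null hC h⟩
  rw [← measure_congr (Φ.invFun_toFun hC h)]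
  exact Φ.symm.toFun_null (Φ.measurableSet_toFun hC h) (Φ.toFun_subset hC h) h0

theorem toFun_iUnion {ι : Type*} [Countable ι] {C : ι → Set Ω} (hC : ∀ i, MeasurableSet (C i))
    (h : ∀ i, C i ⊆ Φ.dom) : Φ.toFun (⋃ i, C i) =ᵐ[μ] ⋃ i, Φ.toFun (C i) := by
  have hU : MeasurableSet (⋃ i, C i) := .iUnion hC
  have hU' : ⋃ i, C i ⊆ Φ.dom := Set.iUnion_subset h
  have hV : MeasurableSet (⋃ i, Φ.toFun (C i)) :=
    .iUnion fun i ↦ Φ.measurableSet_toFun (hC i) (h i)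
  have hV' : ⋃ i, Φ.toFun (C i) ⊆ Φ.cod := Set.iUnion_subset fun i ↦ Φ.toFun_subset (hC i) (h i)
  apply EventuallyLE.antisymm
  · rw [Φ.toFun_le_iff_le_invFun hU hU' hV hV']
    refine (Filter.EventuallyLE.countable_iUnion fun i ↦ ?_).trans
      (Set.iUnion_subset fun _ ↦ le_rfl).eventuallyLE
    rw [← Φ.toFun_le_iff_le_invFun (hC i) (h i) hV hV']
    exact (Set.subset_iUnion (fun i ↦ Φ.toFun (C i)) i).eventuallyLE
  · refine (Filter.EventuallyLE.countable_iUnion fun i ↦ ?_).trans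
      (Set.iUnion_subset fun _ ↦ le_rfl).eventuallyLE
    exact (Φ.toFun_le_toFun_iff (hC i) (h i) hU hU').2 (Set.subset_iUnion C i).eventuallyLE

theorem toFun_union {C C' : Set Ω} (hC : MeasurableSet C) (h : C ⊆ Φ.dom)
    (hC' : MeasurableSet C') (h' : C' ⊆ Φ.dom) :
    Φ.toFun (C ∪ C') =ᵐ[μ] (Φ.toFun C ∪ Φ.toFun C' : Set Ω) := by
  have := Φ.toFun_iUnion (C := fun b : Bool ↦ cond b C C') (Bool.forall_bool.2 ⟨hC', hC⟩)
    (Bool.forall_bool.2 ⟨h', h⟩)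
  rw [Set.union_eq_iUnion, Set.union_eq_iUnion]
  exact this.trans (.of_eq (Set.iUnion_congr (Bool.forall_bool.2 ⟨rfl, rfl⟩)))

theorem toFun_inter {C C' : Set Ω} (hC : MeasurableSet C) (h : C ⊆ Φ.dom)
    (hC' : MeasurableSet C') (h' : C' ⊆ Φ.dom) :
    Φ.toFun (C ∩ C') =ᵐ[μ] (Φ.toFun C ∩ Φ.toFun C' : Set Ω) := by
  have hI : MeasurableSet (C ∩ C') := hC.inter hC'
  have hI' : C ∩ C' ⊆ Φ.dom := Set.inter_subset_left.trans h
  have hJ : MeasurableSet (Φ.toFun C ∩ Φ.toFun C') :=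
    (Φ.measurableSet_toFun hC h).inter (Φ.measurableSet_toFun hC' h')
  have hJ' : Φ.toFun C ∩ Φ.toFun C' ⊆ Φ.cod := Set.inter_subset_left.trans (Φ.toFun_subset hC h)
  apply EventuallyLE.antisymm
  · have hle := (Φ.toFun_le_toFun_iff hI hI' hC h).2 Set.inter_subset_left.eventuallyLE
    have hle' := (Φ.toFun_le_toFun_iff hI hI' hC' h').2 Set.inter_subset_right.eventuallyLE
    filter_upwards [hle, hle'] with x hx hx' hmem using ⟨hx hmem, hx' hmem⟩
  · rw [Φ.le_toFun_iff_invFun_le hI hI' hJ hJ']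
    have hle := (Φ.le_toFun_iff_invFun_le hC h hJ hJ').1 Set.inter_subset_left.eventuallyLE
    have hle' := (Φ.le_toFun_iff_invFun_le hC' h' hJ hJ').1 Set.inter_subset_right.eventuallyLE
    filter_upwards [hle, hle'] with x hx hx' hmem using ⟨hx hmem, hx' hmem⟩

theorem aedisjoint_toFun {C C' : Set Ω} (hC : MeasurableSet C) (h : C ⊆ Φ.dom)
    (hC' : MeasurableSet C') (h' : C' ⊆ Φ.dom) (hCC' : AEDisjoint μ C C') :
    AEDisjoint μ (Φ.toFun C) (Φ.toFun C') := by
  rw [AEDisjoint, ← measure_congr (Φ.toFun_inter hC h hC' h')]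
  exact Φ.toFun_null (hC.inter hC') (Set.inter_subset_left.trans h) hCC'

theorem toFun_dom_diff {C : Set Ω} (hC : MeasurableSet C) (h : C ⊆ Φ.dom) :
    Φ.toFun (Φ.dom \ C) =ᵐ[μ] (Φ.cod \ Φ.toFun C : Set Ω) := by
  have hD : MeasurableSet (Φ.dom \ C) := Φ.measurableSet_dom.diff hC
  have hunion := Φ.toFun_union hC h hD Set.sdiff_subset
  rw [Set.union_sdiff_cancel h] at hunion
  have hdisj := Φ.aedisjoint_toFun hC h hD Set.sdiff_subset disjoint_sdiff_self_right.aedisjoint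
  filter_upwards [(hunion.symm.trans Φ.toFun_dom).mem_iff, measure_eq_zero_iff_ae_notMem.1 hdisj]
    with x hcod hinter
  refine propext (?_ : x ∈ Φ.toFun (Φ.dom \ C) ↔ x ∈ Φ.cod ∧ x ∉ Φ.toFun C)
  rw [← hcod, Set.mem_union]
  rw [Set.mem_inter_iff] at hinter
  tauto

end PartialSetAut

/-! ### Lifting functions along a partial set automorphism -/

section Lift

variable {Ω : Type*} [MeasurableSpace Ω] {μ : Measure Ω} {Φ : PartialSetAut μ}
  {Y Z : Type*} [MeasurableSpace Y] [MeasurableSpace Z]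

/-- `g` is a lift of `f` along `Φ`: the preimages of any measurable set under `f` and `g`
correspond to each other under `Φ`. When `Φ` is induced by a point map `τ : cod → dom`, this means
that `g = f ∘ τ` almost everywhere on `cod`. -/
structure IsLift (Φ : PartialSetAut μ) (f g : Ω → Y) : Prop where
  measurable_left : Measurable f
  measurable_right : Measurable g
  preimage_ae_eq : ∀ B, MeasurableSet B →
    (g ⁻¹' B ∩ Φ.cod : Set Ω) =ᵐ[μ] Φ.toFun (f ⁻¹' B ∩ Φ.dom)

namespace IsLift

theorem comp {f g : Ω → Y} (h : IsLift Φ f g) {ψ : Y → Z} (hψ : Measurable ψ) :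
    IsLift Φ (ψ ∘ f) (ψ ∘ g) :=
  ⟨hψ.comp h.measurable_left, hψ.comp h.measurable_right, fun _ hB ↦ h.preimage_ae_eq _ (hψ hB)⟩

theorem measurableSet_preimage_left {f g : Ω → Y} (h : IsLift Φ f g) {B : Set Y}
    (hB : MeasurableSet B) : MeasurableSet (f ⁻¹' B ∩ Φ.dom) :=
  (h.measurable_left hB).inter Φ.measurableSet_dom

theorem measurableSet_preimage_right {f g : Ω → Y} (h : IsLift Φ f g) {B : Set Y}
    (hB : MeasurableSet B) : MeasurableSet (g ⁻¹' B ∩ Φ.cod) :=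
  (h.measurable_right hB).inter Φ.measurableSet_cod

theorem symm {f g : Ω → Y} (h : IsLift Φ f g) : IsLift Φ.symm g f := by
  refine ⟨h.measurable_right, h.measurable_left, fun B hB ↦ ?_⟩
  have hf := h.measurableSet_preimage_left hB
  have hm := Φ.toFun_mem _ hf Set.inter_subset_right
  exact (Φ.invFun_toFun hf Set.inter_subset_right).symm.trans
    (Φ.symm.toFun_congr hm.1 hm.2 (h.measurableSet_preimage_right hB) Set.inter_subset_right
      (h.preimage_ae_eq B hB).symm)

theorem congr_right {f g g' : Ω → Y} (h : IsLift Φ f g) (hg' : Measurable g')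
    (hgg' : g =ᵐ[μ.restrict Φ.cod] g') : IsLift Φ f g' := by
  refine ⟨h.measurable_left, hg', fun B hB ↦ EventuallyEq.trans ?_ (h.preimage_ae_eq B hB)⟩
  filter_upwards [(ae_restrict_iff' Φ.measurableSet_cod).1 hgg'] with x hx
  exact propext (and_congr_left fun hmem ↦ by simp only [Set.mem_preimage, hx hmem])

theorem congr_left {f f' g : Ω → Y} (h : IsLift Φ f g) (hf' : Measurable f')
    (hff' : f =ᵐ[μ.restrict Φ.dom] f') : IsLift Φ f' g :=
  (h.symm.congr_right hf' hff').symm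

theorem ae_restrict_iff {f g : Ω → Y} (h : IsLift Φ f g) {q : Y → Prop}
    (hq : MeasurableSet {y | q y}) :
    (∀ᵐ x ∂μ.restrict Φ.dom, q (f x)) ↔ ∀ᵐ x ∂μ.restrict Φ.cod, q (g x) := by
  rw [ae_iff, ae_iff, Measure.restrict_apply' Φ.measurableSet_dom,
    Measure.restrict_apply' Φ.measurableSet_cod]
  change μ (f ⁻¹' {y | q y}ᶜ ∩ Φ.dom) = 0 ↔ μ (g ⁻¹' {y | q y}ᶜ ∩ Φ.cod) = 0
  rw [measure_congr (h.preimage_ae_eq _ hq.compl),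
    Φ.toFun_null_iff (h.measurableSet_preimage_left hq.compl) Set.inter_subset_right]

theorem map_eq {f g : Ω → Y} (h : IsLift Φ f g) {w : Ω → ℝ≥0∞}
    (hw : ∀ C, MeasurableSet C → C ⊆ Φ.cod → μ (Φ.invFun C) = ∫⁻ x in C, w x ∂μ) :
    ((μ.restrict Φ.cod).withDensity w).map g = (μ.restrict Φ.dom).map f := by
  ext B hB
  rw [Measure.map_apply h.measurable_right hB, Measure.map_apply h.measurable_left hB,
    withDensity_apply _ (h.measurable_right hB), Measure.restrict_restrict (h.measurable_right hB),
    ← hw _ (h.measurableSet_preimage_right hB) Set.inter_subset_right,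
    Measure.restrict_apply (h.measurable_left hB)]
  exact measure_congr (h.symm.preimage_ae_eq B hB).symm

theorem ae_eq [MeasurableSpace.CountablySeparated Y] {f g g' : Ω → Y}
    (h : IsLift Φ f g) (h' : IsLift Φ f g') : g =ᵐ[μ.restrict Φ.cod] g' := by
  refine EventuallyEq.of_forall_separating_preimage MeasurableSet fun B hB ↦ ?_
  refine (ae_restrict_iff' Φ.measurableSet_cod).2 ?_
  filter_upwards [(h.preimage_ae_eq B hB).trans (h'.preimage_ae_eq B hB).symm] with x hx hmem
  exact propext ((and_iff_left hmem).symm.trans (hx.to_iff.trans (and_iff_left hmem)))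

theorem of_generateFrom {f g : Ω → Y} (hf : Measurable f) (hg : Measurable g) {S : Set (Set Y)}
    (hS : ‹MeasurableSpace Y› = MeasurableSpace.generateFrom S)
    (h : ∀ B ∈ S, (g ⁻¹' B ∩ Φ.cod : Set Ω) =ᵐ[μ] Φ.toFun (f ⁻¹' B ∩ Φ.dom)) :
    IsLift Φ f g := by
  have hmeas : ∀ B, MeasurableSet[.generateFrom S] B → MeasurableSet B := fun _ hB ↦ hS ▸ hB
  refine ⟨hf, hg, fun B hB ↦ ?_⟩
  rw [hS] at hB
  refine MeasurableSpace.generateFrom_induction S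
    (fun B _ ↦ (g ⁻¹' B ∩ Φ.cod : Set Ω) =ᵐ[μ] Φ.toFun (f ⁻¹' B ∩ Φ.dom))
    (fun B hB _ ↦ h B hB) ?_ ?_ ?_ B hB
  · rw [Set.preimage_empty, Set.preimage_empty, Set.empty_inter, Set.empty_inter]
    exact (ae_eq_empty.2 (Φ.toFun_null .empty (Set.empty_subset _) measure_empty)).symm
  · intro B hB ih
    have hcompl (u : Ω → Y) (D : Set Ω) : u ⁻¹' Bᶜ ∩ D = D \ (u ⁻¹' B ∩ D) := by
      rw [Set.preimage_compl, Set.sdiff_inter_self_eq_sdiff, Set.sdiff_eq_compl_inter]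
    rw [hcompl, hcompl]
    exact ((ae_eq_refl _).diff ih).trans
      (Φ.toFun_dom_diff ((hf (hmeas _ hB)).inter Φ.measurableSet_dom)
        Set.inter_subset_right).symm
  · intro B hB ih
    simp only [Set.preimage_iUnion, Set.iUnion_inter]
    exact (Filter.EventuallyEq.countable_iUnion ih).trans
      (Φ.toFun_iUnion (fun n ↦ (hf (hmeas _ (hB n))).inter Φ.measurableSet_dom)
        fun n ↦ Set.inter_subset_right).symm

theorem prodMk {f g : Ω → Y} {f' g' : Ω → Z} (h : IsLift Φ f g) (h' : IsLift Φ f' g') :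
    IsLift Φ (fun x ↦ (f x, f' x)) (fun x ↦ (g x, g' x)) := by
  refine of_generateFrom (h.measurable_left.prodMk h'.measurable_left)
    (h.measurable_right.prodMk h'.measurable_right) generateFrom_prod.symm ?_
  rintro _ ⟨A, hA, B, hB, rfl⟩
  rw [Set.mk_preimage_prod, Set.mk_preimage_prod, Set.inter_inter_distrib_right (g ⁻¹' A),
    Set.inter_inter_distrib_right (f ⁻¹' A)]
  exact ((h.preimage_ae_eq A hA).inter (h'.preimage_ae_eq B hB)).trans
    (Φ.toFun_inter (h.measurableSet_preimage_left hA) Set.inter_subset_right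
      (h'.measurableSet_preimage_left hB) Set.inter_subset_right).symm

theorem pi {ι : Type*} {Y : ι → Type*} [∀ i, MeasurableSpace (Y i)] {f g : ∀ i, Ω → Y i}
    (h : ∀ i, IsLift Φ (f i) (g i)) : IsLift Φ (fun x i ↦ f i x) (fun x i ↦ g i x) := by
  refine of_generateFrom (measurable_pi_iff.2 fun i ↦ (h i).measurable_left)
    (measurable_pi_iff.2 fun i ↦ (h i).measurable_right)
    (MeasurableSpace.generateFrom_iUnion_measurableSet _).symm ?_
  rintro B hB
  obtain ⟨i, A, hA, rfl⟩ := Set.mem_iUnion.1 hB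
  exact (h i).preimage_ae_eq A hA

end IsLift

open Classical in
theorem isLift_decide_mem (Φ : PartialSetAut μ) {C : Set Ω} (hC : MeasurableSet C) :
    IsLift Φ (fun x ↦ decide (x ∈ C)) (fun x ↦ decide (x ∈ Φ.toFun (C ∩ Φ.dom))) := by
  have hpre (D : Set Ω) : (fun x ↦ decide (x ∈ D)) ⁻¹' {true} = D := by
    ext x
    exact decide_eq_true_iff
  have hD := Φ.toFun_mem (C ∩ Φ.dom) (hC.inter Φ.measurableSet_dom) Set.inter_subset_right
  refine .of_generateFrom (S := {{true}}) (measurable_to_bool ((hpre C).symm ▸ hC))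
    (measurable_to_bool ((hpre _).symm ▸ hD.1)) ?_ ?_
  · refine le_antisymm (fun B _ ↦ ?_) fun _ _ ↦ trivial
    exact @measurable_to_bool _ (.generateFrom {{true}}) id (.basic _ rfl) B trivial
  · rintro _ rfl
    exact .of_eq (by rw [hpre, hpre, Set.inter_eq_left.2 hD.2])

theorem exists_isLift_bool (Φ : PartialSetAut μ) {f : Ω → Bool} (hf : Measurable f) :
    ∃ g, IsLift Φ f g := by
  classical
  have hlift := isLift_decide_mem Φ (hf (measurableSet_singleton true))
  simp only [Set.mem_preimage, Set.mem_singleton_iff, Bool.decide_eq_true] at hlift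
  exact ⟨_, hlift⟩

theorem exists_natBool_coding (Y : Type*) [MeasurableSpace Y] [StandardBorelSpace Y]
    [Nonempty Y] : ∃ (e : Y → ℕ → Bool) (d : (ℕ → Bool) → Y),
      Measurable e ∧ Measurable d ∧ d ∘ e = id := by
  have he := MeasurableSpace.measurable_mapNatBool Y
  obtain ⟨d, hd, hde⟩ := (he.measurableEmbedding
    (MeasurableSpace.injective_mapNatBool Y)).exists_measurable_extend measurable_id
      fun _ ↦ inferInstance
  exact ⟨_, d, he, hd, hde⟩

theorem exists_isLift [StandardBorelSpace Y] [Nonempty Y] (Φ : PartialSetAut μ) {f : Ω → Y}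
    (hf : Measurable f) : ∃ g, IsLift Φ f g := by
  obtain ⟨e, d, he, hd, hde⟩ := exists_natBool_coding Y
  choose g hg using fun n ↦ exists_isLift_bool Φ (measurable_pi_iff.1 (he.comp hf) n)
  have hlift := (IsLift.pi hg).comp hd
  have hdef : d ∘ (fun x n ↦ (e ∘ f) x n) = f := congrArg (· ∘ f) hde
  exact ⟨_, hdef ▸ hlift⟩

end Lift

/-! ### Composition operators -/

section CompOp

variable {Ω : Type*} [MeasurableSpace Ω] {μ : Measure Ω} {𝕜 : Type*} [RCLike 𝕜]
  {Φ : PartialSetAut μ}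

theorem IsLift.congr_ae {f g : Ω →ₘ[μ] 𝕜} {f' g' : Ω → 𝕜} (h : IsLift Φ f' g')
    (hf : f =ᵐ[μ] f') (hg : g =ᵐ[μ] g') : IsLift Φ f g :=
  (h.congr_left f.measurable (ae_restrict_of_ae hf.symm)).congr_right g.measurable
    (ae_restrict_of_ae hg.symm)

theorem IsLift.chi_cod_mul_eq {f : Ω → 𝕜} {g g' : Ω →ₘ[μ] 𝕜} (h : IsLift Φ f g)
    (h' : IsLift Φ f g') : chi μ 𝕜 Φ.cod * g = chi μ 𝕜 Φ.cod * g' := by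
  rw [← sub_eq_zero, ← mul_sub, chi_mul_eq_zero_iff Φ.measurableSet_cod]
  filter_upwards [(ae_restrict_iff' Φ.measurableSet_cod).1 (h.ae_eq h'), AEEqFun.coeFn_sub g g']
    with x heq hsub hx
  rw [hsub, Pi.sub_apply, heq hx, sub_self]

theorem exists_isLift_supported (Φ : PartialSetAut μ) (f : Ω →ₘ[μ] 𝕜) :
    ∃ g : Ω →ₘ[μ] 𝕜, IsLift Φ f g ∧ chi μ 𝕜 Φ.cod * g = g := by
  obtain ⟨g, hg⟩ := exists_isLift Φ f.measurable
  let G : Ω →ₘ[μ] 𝕜 := AEEqFun.mk g hg.measurable_right.aestronglyMeasurable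
  refine ⟨chi μ 𝕜 Φ.cod * G, hg.congr_right (AEEqFun.measurable _) ?_, ?_⟩
  · refine (ae_restrict_iff' Φ.measurableSet_cod).2 ?_
    filter_upwards [coeFn_chi_mul Φ.measurableSet_cod G,
      AEEqFun.coeFn_mk g hg.measurable_right.aestronglyMeasurable] with x hmul hG hx
    rw [hmul, Set.indicator_of_mem hx, hG]
  · rw [← mul_assoc, chi_mul_self Φ.measurableSet_cod]

/-- The composition operator `T_Φ`: it sends `f` to its lift along `Φ`, extended by zero outside
`D_Φ`. -/
def compOp (𝕜 : Type*) [RCLike 𝕜] (Φ : PartialSetAut μ) :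
    (Ω →ₘ[μ] 𝕜) →ₗ[𝕜] (Ω →ₘ[μ] 𝕜) where
  toFun f := (exists_isLift_supported Φ f).choose
  map_add' f g := by
    obtain ⟨hf, hf'⟩ := (exists_isLift_supported Φ f).choose_spec
    obtain ⟨hg, hg'⟩ := (exists_isLift_supported Φ g).choose_spec
    obtain ⟨hfg, hfg'⟩ := (exists_isLift_supported Φ (f + g)).choose_spec
    have hadd := ((hf.prodMk hg).comp (measurable_fst.add measurable_snd)).congr_ae
      (AEEqFun.coeFn_add f g) (AEEqFun.coeFn_add _ _)
    rw [← hfg', hfg.chi_cod_mul_eq hadd, mul_add, hf', hg']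
  map_smul' c f := by
    obtain ⟨hf, hf'⟩ := (exists_isLift_supported Φ f).choose_spec
    obtain ⟨hcf, hcf'⟩ := (exists_isLift_supported Φ (c • f)).choose_spec
    have hsmul := (hf.comp (measurable_const_smul c)).congr_ae
      (AEEqFun.coeFn_smul c f) (AEEqFun.coeFn_smul c _)
    rw [← hcf', hcf.chi_cod_mul_eq hsmul, mul_smul_comm, hf', RingHom.id_apply]

variable (Φ)

theorem isLift_compOp (f : Ω →ₘ[μ] 𝕜) : IsLift Φ f (compOp 𝕜 Φ f) :=
  (exists_isLift_supported Φ f).choose_spec.1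

theorem chi_cod_mul_compOp (f : Ω →ₘ[μ] 𝕜) :
    chi μ 𝕜 Φ.cod * compOp 𝕜 Φ f = compOp 𝕜 Φ f :=
  (exists_isLift_supported Φ f).choose_spec.2

variable {Φ} in
theorem compOp_eq {f g : Ω →ₘ[μ] 𝕜} (h : IsLift Φ f g) :
    compOp 𝕜 Φ f = chi μ 𝕜 Φ.cod * g := by
  rw [← chi_cod_mul_compOp, (isLift_compOp Φ f).chi_cod_mul_eq h]

theorem compOp_apply_eq_zero (f : Ω →ₘ[μ] 𝕜) : ∀ᵐ x ∂μ, x ∉ Φ.cod → compOp 𝕜 Φ f x = 0 :=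
  (chi_mul_eq_self_iff Φ.measurableSet_cod).1 (chi_cod_mul_compOp Φ f)

theorem compOp_mul (f g : Ω →ₘ[μ] 𝕜) :
    compOp 𝕜 Φ (f * g) = compOp 𝕜 Φ f * compOp 𝕜 Φ g := by
  have h := ((isLift_compOp Φ f).prodMk (isLift_compOp Φ g)).comp
    (measurable_fst.mul measurable_snd)
  rw [compOp_eq (h.congr_ae (AEEqFun.coeFn_mul f g) (AEEqFun.coeFn_mul _ _)), ← mul_assoc,
    chi_cod_mul_compOp]

theorem compOp_symm_compOp (f : Ω →ₘ[μ] 𝕜) :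
    compOp 𝕜 Φ.symm (compOp 𝕜 Φ f) = chi μ 𝕜 Φ.dom * f :=
  compOp_eq (isLift_compOp Φ f).symm

theorem compOp_compOp_symm (f : Ω →ₘ[μ] 𝕜) :
    compOp 𝕜 Φ (compOp 𝕜 Φ.symm f) = chi μ 𝕜 Φ.cod * f :=
  compOp_symm_compOp Φ.symm f

theorem compOp_chi {C : Set Ω} (hC : MeasurableSet C) :
    compOp 𝕜 Φ (chi μ 𝕜 C) = chi μ 𝕜 (Φ.toFun (C ∩ Φ.dom)) := by
  classical
  have hD := Φ.toFun_mem _ (hC.inter Φ.measurableSet_dom) Set.inter_subset_right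
  have hbool (D : Set Ω) : (D.indicator fun _ ↦ (1 : 𝕜)) =
      (fun b : Bool ↦ if b then 1 else 0) ∘ fun x ↦ decide (x ∈ D) := by
    ext x
    simp only [Set.indicator_apply, Function.comp_apply, decide_eq_true_eq]
  have hlift : IsLift Φ (chi μ 𝕜 C) (chi μ 𝕜 (Φ.toFun (C ∩ Φ.dom))) :=
    ((isLift_decide_mem Φ hC).comp .of_discrete).congr_ae
      ((coeFn_chi hC).trans (.of_eq (hbool _))) ((coeFn_chi hD.1).trans (.of_eq (hbool _)))
  rw [compOp_eq hlift, chi_mul_chi_of_subset hD.1 Φ.measurableSet_cod hD.2]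

theorem tendsto_compOp {f : ℕ → Ω →ₘ[μ] 𝕜} {g : Ω →ₘ[μ] 𝕜}
    (h : ∀ᵐ x ∂μ, Tendsto (fun n ↦ f n x) atTop (𝓝 (g x))) :
    ∀ᵐ x ∂μ, Tendsto (fun n ↦ compOp 𝕜 Φ (f n) x) atTop (𝓝 (compOp 𝕜 Φ g x)) := by
  have hlift := (IsLift.pi fun n ↦ isLift_compOp Φ (f n)).prodMk (isLift_compOp Φ g)
  have hmeas : MeasurableSet {y : (ℕ → 𝕜) × 𝕜 | Tendsto y.1 atTop (𝓝 y.2)} :=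
    measurableSet_tendsto_fun (fun n ↦ (measurable_pi_apply n).comp measurable_fst) measurable_snd
  have hcod := (hlift.ae_restrict_iff hmeas).1 (ae_restrict_of_ae h)
  filter_upwards [(ae_restrict_iff' Φ.measurableSet_cod).1 hcod,
    ae_all_iff.2 fun n ↦ compOp_apply_eq_zero Φ (f n), compOp_apply_eq_zero Φ g] with x hmem hf hg
  by_cases hx : x ∈ Φ.cod
  · exact hmem hx
  · simp only [hf _ hx, hg hx, tendsto_const_nhds_iff]

theorem isCompositionOp_compOp : IsCompositionOp Φ (compOp 𝕜 Φ) where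
  map_indicator C hC f hf := by
    rw [(eq_chi_iff hC).2 hf, compOp_chi Φ hC]
    exact coeFn_chi (Φ.measurableSet_toFun (hC.inter Φ.measurableSet_dom) Set.inter_subset_right)
  map_lim _ _ h := tendsto_compOp Φ h

theorem mk_simpleFunc_mem_span_chi (s : SimpleFunc Ω 𝕜) :
    AEEqFun.mk s s.aestronglyMeasurable ∈
      Submodule.span 𝕜 {f : Ω →ₘ[μ] 𝕜 | ∃ A, MeasurableSet A ∧ f = chi μ 𝕜 A} := by
  induction s using SimpleFunc.induction with
  | @const c A hA =>
    have hsmul : AEEqFun.mk (SimpleFunc.piecewise A hA (.const Ω c) (.const Ω 0))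
        (SimpleFunc.aestronglyMeasurable _) = c • chi μ 𝕜 A := by
      rw [chi, dif_pos hA, AEEqFun.smul_mk, AEEqFun.mk_eq_mk]
      refine .of_forall fun x ↦ ?_
      by_cases hx : x ∈ A <;> simp [hx]
    rw [hsmul]
    exact Submodule.smul_mem _ c (Submodule.subset_span ⟨A, hA, rfl⟩)
  | add _ hf hg => exact Submodule.add_mem _ hf hg

theorem exists_simpleFunc_tendsto_ae (f : Ω →ₘ[μ] 𝕜) : ∃ s : ℕ → SimpleFunc Ω 𝕜,
    ∀ᵐ x ∂μ, Tendsto (fun n ↦ (AEEqFun.mk (s n) (s n).aestronglyMeasurable : Ω →ₘ[μ] 𝕜) x)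
      atTop (𝓝 (f x)) := by
  refine ⟨f.stronglyMeasurable.approx, ?_⟩
  filter_upwards [ae_all_iff.2 fun n ↦ AEEqFun.coeFn_mk (f.stronglyMeasurable.approx n)
    (SimpleFunc.aestronglyMeasurable _ (μ := μ))] with x hx
  simpa only [hx] using f.stronglyMeasurable.tendsto_approx x

variable {Φ} in
theorem IsCompositionOp.eq_compOp {V : (Ω →ₘ[μ] 𝕜) →ₗ[𝕜] (Ω →ₘ[μ] 𝕜)}
    (hV : IsCompositionOp Φ V) : V = compOp 𝕜 Φ := by
  have hsimple (s : SimpleFunc Ω 𝕜) : V (AEEqFun.mk s s.aestronglyMeasurable) =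
      compOp 𝕜 Φ (AEEqFun.mk s s.aestronglyMeasurable) := by
    refine LinearMap.eqOn_span ?_ (mk_simpleFunc_mem_span_chi s)
    rintro _ ⟨A, hA, rfl⟩
    exact AEEqFun.ext ((hV.map_indicator A hA _ (coeFn_chi hA)).trans
      ((isCompositionOp_compOp Φ).map_indicator A hA _ (coeFn_chi hA)).symm)
  refine LinearMap.ext fun f ↦ ?_
  obtain ⟨s, hs⟩ := exists_simpleFunc_tendsto_ae f
  have hlim := hV.map_lim _ f hs
  simp only [hsimple] at hlim
  exact AEEqFun.ext (AEEqFun.tendsto_ae_unique hlim (tendsto_compOp Φ hs))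

end CompOp

/-! ### Gluing measurable functions over a localizable measure space -/

section Glue

variable {Ω : Type*} [MeasurableSpace Ω] {μ : Measure Ω} {ι : Type*} {A : ι → Set Ω}

theorem IsLocalizable.exists_glue_set (hμ : IsLocalizable μ) (hA : ∀ i, MeasurableSet (A i))
    {B : ι → Set Ω} (hB : ∀ i, MeasurableSet (B i))
    (hBA : ∀ i j, ∀ᵐ x ∂μ, x ∈ A i → x ∈ A j → (x ∈ B i ↔ x ∈ B j)) :
    ∃ S, MeasurableSet S ∧ ∀ i, ∀ᵐ x ∂μ, x ∈ A i → (x ∈ S ↔ x ∈ B i) := by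
  obtain ⟨S, hS, hupper, hleast⟩ := hμ.exists_essSup (Set.range fun i ↦ A i ∩ B i)
    (Set.forall_mem_range.2 fun i ↦ (hA i).inter (hB i))
  refine ⟨S, hS, fun i ↦ ?_⟩
  have hle : (A i ∩ B i : Set Ω) ≤ᵐ[μ] S := ae_le_set.2 (hupper _ ⟨i, rfl⟩)
  have hge : S ≤ᵐ[μ] ((A i)ᶜ ∪ B i : Set Ω) := by
    refine ae_le_set.2 (hleast _ ((hA i).compl.union (hB i)) (Set.forall_mem_range.2 fun j ↦ ?_))
    refine ae_le_set.1 ?_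
    filter_upwards [hBA j i] with x hx hxj
    exact or_iff_not_imp_left.2 fun hxi ↦ (hx hxj.1 (not_not.1 hxi)).1 hxj.2
  filter_upwards [hle, hge] with x hle hge hx
  exact ⟨fun hxS ↦ (hge hxS).resolve_left (not_not.2 hx), fun hxB ↦ hle ⟨hx, hxB⟩⟩

theorem IsLocalizable.exists_glue (hμ : IsLocalizable μ) {Y : Type*} [MeasurableSpace Y]
    [StandardBorelSpace Y] [Nonempty Y] (hA : ∀ i, MeasurableSet (A i)) {f : ι → Ω → Y}
    (hf : ∀ i, Measurable (f i)) (hfA : ∀ i j, ∀ᵐ x ∂μ, x ∈ A i → x ∈ A j → f i x = f j x) :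
    ∃ g : Ω → Y, Measurable g ∧ ∀ i, ∀ᵐ x ∂μ, x ∈ A i → g x = f i x := by
  classical
  obtain ⟨e, d, he, hd, hde⟩ := exists_natBool_coding Y
  choose S hS hSA using fun n ↦ hμ.exists_glue_set hA
    (fun i ↦ measurable_pi_iff.1 (he.comp (hf i)) n (measurableSet_singleton true))
    (fun i j ↦ by
      filter_upwards [hfA i j] with x hx hi hj
      simp only [Set.mem_preimage, Function.comp_apply, hx hi hj])
  have hmeas : Measurable fun x n ↦ decide (x ∈ S n) :=
    measurable_pi_iff.2 fun n ↦
      (Measurable.of_discrete (f := fun q : Prop ↦ decide q)).comp (hS n).mem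
  refine ⟨fun x ↦ d fun n ↦ decide (x ∈ S n), hd.comp hmeas, fun i ↦ ?_⟩
  filter_upwards [ae_all_iff.2 fun n ↦ hSA n i] with x hx hxi
  have hcode : (fun n ↦ decide (x ∈ S n)) = e (f i x) :=
    funext fun n ↦ Bool.eq_iff_iff.2 (by simpa using hx n hxi)
  rw [hcode]
  exact congrFun hde (f i x)

end Glue

/-! ### Radon–Nikodym derivatives -/

section RadonNikodym

variable {Ω : Type*} [MeasurableSpace Ω] {μ ν : Measure Ω}

/-- Semifiniteness of a measure, in a form convenient for extracting sets of finite measure: a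
measurable set has measurable subsets of finite measure exceeding any given bound below its own
measure. -/
def IsSemifinite (ν : Measure Ω) : Prop :=
  ∀ ⦃A : Set Ω⦄, MeasurableSet A → ∀ ⦃c : ℝ≥0∞⦄, c < ν A →
    ∃ B ⊆ A, MeasurableSet B ∧ ν B < ∞ ∧ c < ν B

theorem isSemifinite_iff_eq_iSup : IsSemifinite ν ↔ ∀ A : Set Ω, MeasurableSet A →
    ν A = ⨆ (B : Set Ω) (_ : MeasurableSet B) (_ : B ⊆ A) (_ : ν B < ∞), ν B := by
  refine forall₂_congr fun A _ ↦ ⟨fun h ↦ ?_, fun h c hc ↦ ?_⟩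
  · refine le_antisymm (le_of_forall_lt fun c hc ↦ ?_)
      (iSup₂_le fun B _ ↦ iSup₂_le fun hBA _ ↦ measure_mono hBA)
    obtain ⟨B, hBA, hB, hfin, hlt⟩ := h hc
    simp only [lt_iSup_iff]
    exact ⟨B, hB, hBA, hfin, hlt⟩
  · rw [h] at hc
    simp only [lt_iSup_iff] at hc
    obtain ⟨B, hB, hBA, hfin, hlt⟩ := hc
    exact ⟨B, hBA, hB, hfin, hlt⟩

theorem IsLocalizable.isSemifinite (hμ : IsLocalizable μ) : IsSemifinite μ :=
  isSemifinite_iff_eq_iSup.2 hμ.semifinite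

theorem IsSemifinite.restrict (hν : IsSemifinite ν) {D : Set Ω} (hD : MeasurableSet D) :
    IsSemifinite (ν.restrict D) := by
  intro A hA c hc
  rw [Measure.restrict_apply hA] at hc
  obtain ⟨B, hBAD, hB, hfin, hlt⟩ := hν (hA.inter hD) hc
  refine ⟨B, hBAD.trans Set.inter_subset_left, hB, ?_⟩
  rw [Measure.restrict_eq_self ν (hBAD.trans Set.inter_subset_right)]
  exact ⟨hfin, hlt⟩

theorem IsLocalizable.restrict (hμ : IsLocalizable μ) {D : Set Ω} (hD : MeasurableSet D) :
    IsLocalizable (μ.restrict D) := by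
  refine ⟨isSemifinite_iff_eq_iSup.1 (hμ.isSemifinite.restrict hD), fun F hF ↦ ?_⟩
  have hinter (A S : Set Ω) : μ.restrict D (A \ S) = μ ((A ∩ D) \ S) := by
    rw [Measure.restrict_apply' hD, Set.inter_sdiff_right_comm]
  obtain ⟨S, hS, hupper, hleast⟩ := hμ.exists_essSup ((· ∩ D) '' F)
    (Set.forall_mem_image.2 fun A hA ↦ (hF A hA).inter hD)
  rw [Set.forall_mem_image] at hupper
  refine ⟨S, hS, fun A hA ↦ (hinter A S).trans (hupper hA), fun S' hS' hF' ↦ ?_⟩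
  refine Measure.absolutelyContinuous_of_le Measure.restrict_le_self (hleast S' hS' ?_)
  exact Set.forall_mem_image.2 fun A hA ↦ (hinter A S').symm.trans (hF' A hA)

theorem IsSemifinite.sigmaFinite_restrict (hμ : IsSemifinite μ) (hμν : μ ≪ ν) {D : Set Ω}
    (hD : MeasurableSet D) (hfin : ν D < ∞) : SigmaFinite (μ.restrict D) := by
  have : Fact (ν D < ∞) := ⟨hfin⟩
  set s := (μ.restrict D).sigmaFiniteSetWRT (ν.restrict D)
  have hs : MeasurableSet s := measurableSet_sigmaFiniteSetWRT
  have hcompl : μ.restrict D sᶜ = 0 := by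
    by_contra hne
    obtain ⟨B, hBs, -, hBfin, hBpos⟩ := hμ.restrict hD hs.compl (pos_iff_ne_zero.2 hne)
    refine hBfin.ne (measure_eq_top_of_subset_compl_sigmaFiniteSetWRT (ν := ν.restrict D) hBs ?_)
    exact fun hνB ↦ hBpos.ne' (hμν.restrict D hνB)
  rw [← Measure.restrict_eq_self_of_ae_mem (s := s) (mem_ae_iff.2 hcompl)]
  infer_instance

theorem IsSemifinite.exists_withDensity_restrict_eq (hμ : IsSemifinite μ) (hνμ : ν ≪ μ)
    (hμν : μ ≪ ν) {D : Set Ω} (hD : MeasurableSet D) (hfin : ν D < ∞) :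
    ∃ f : Ω → ℝ≥0, Measurable f ∧ (μ.withDensity fun x ↦ f x).restrict D = ν.restrict D := by
  have : Fact (ν D < ∞) := ⟨hfin⟩
  have : SigmaFinite (μ.restrict D) := hμ.sigmaFinite_restrict hμν hD hfin
  refine ⟨fun x ↦ ((ν.restrict D).rnDeriv (μ.restrict D) x).toNNReal,
    (Measure.measurable_rnDeriv _ _).ennreal_toNNReal, ?_⟩
  rw [restrict_withDensity hD]
  conv_rhs => rw [← Measure.withDensity_rnDeriv_eq _ _ (hνμ.restrict D)]
  refine withDensity_congr_ae ?_
  filter_upwards [(ν.restrict D).rnDeriv_lt_top (μ.restrict D)] with x hx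
  exact ENNReal.coe_toNNReal hx.ne

theorem IsSemifinite.ae_eq_of_withDensity_restrict_eq (hμ : IsSemifinite μ) (hμν : μ ≪ ν)
    {D : Set Ω} (hD : MeasurableSet D) (hfin : ν D < ∞) {f g : Ω → ℝ≥0} (hf : Measurable f)
    (hg : Measurable g)
    (hfg : (μ.withDensity fun x ↦ f x).restrict D = (μ.withDensity fun x ↦ g x).restrict D) :
    ∀ᵐ x ∂μ, x ∈ D → f x = g x := by
  have : SigmaFinite (μ.restrict D) := hμ.sigmaFinite_restrict hμν hD hfin
  rw [restrict_withDensity hD, restrict_withDensity hD, withDensity_eq_iff_of_sigmaFinite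
    hf.coe_nnreal_ennreal.aemeasurable hg.coe_nnreal_ennreal.aemeasurable] at hfg
  filter_upwards [(ae_restrict_iff' hD).1 hfg] with x hx hxD
  exact ENNReal.coe_injective (hx hxD)

theorem IsSemifinite.eq_of_forall_lt_top_eq (hν : IsSemifinite ν)
    (h : ∀ C, MeasurableSet C → ν C < ∞ → ν C = μ C) : ν = μ := by
  refine Measure.ext fun C hC ↦ (lt_or_eq_of_le le_top).elim (h C hC) fun htop ↦ ?_
  rw [htop, eq_comm, eq_top_iff]
  refine le_of_forall_lt fun c hc ↦ ?_
  obtain ⟨B, hBC, hB, hBfin, hcB⟩ := hν hC (hc.trans_eq htop.symm)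
  exact hcB.trans_le ((h B hB hBfin).trans_le (measure_mono hBC))

theorem IsLocalizable.exists_withDensity_eq (hμ : IsLocalizable μ) (hν : IsSemifinite ν)
    (hνμ : ν ≪ μ) (hμν : μ ≪ ν) :
    ∃ f : Ω → ℝ≥0, Measurable f ∧ ν = μ.withDensity fun x ↦ f x := by
  let ι := {D : Set Ω // MeasurableSet D ∧ ν D < ∞}
  choose f hf hfD using fun D : ι ↦
    hμ.isSemifinite.exists_withDensity_restrict_eq hνμ hμν D.2.1 D.2.2
  obtain ⟨g, hg, hgD⟩ := hμ.exists_glue (fun D : ι ↦ D.2.1) hf fun D D' ↦ by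
    have hinter : ν (D ∩ D' : Set Ω) < ∞ :=
      (measure_mono Set.inter_subset_left).trans_lt D.2.2
    have hfD' := congrArg (Measure.restrict · (D : Set Ω)) (hfD D')
    have hfD := congrArg (Measure.restrict · (D' : Set Ω)) (hfD D)
    simp only [Measure.restrict_restrict D.2.1, Measure.restrict_restrict D'.2.1] at hfD hfD'
    rw [Set.inter_comm] at hfD
    filter_upwards [hμ.isSemifinite.ae_eq_of_withDensity_restrict_eq hμν (D.2.1.inter D'.2.1)
      hinter (hf D) (hf D') (hfD.trans hfD'.symm)] with x hx hxD hxD'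
    exact hx ⟨hxD, hxD'⟩
  refine ⟨g, hg, hν.eq_of_forall_lt_top_eq fun C hC hfin ↦ ?_⟩
  have hC' := DFunLike.congr_fun (hfD ⟨C, hC, hfin⟩) C
  simp only [Measure.restrict_apply hC, Set.inter_self] at hC'
  rw [← hC', withDensity_apply _ hC, withDensity_apply _ hC]
  refine lintegral_congr_ae ((ae_restrict_iff' hC).2 ?_)
  filter_upwards [hgD ⟨C, hC, hfin⟩] with x hx hxC
  rw [hx hxC]

namespace PartialSetAut

variable (Φ : PartialSetAut μ)

/-- The measure `μ ∘ Φ`, extended by zero outside the domain of `Φ`. -/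
def measureComp : Measure Ω :=
  Measure.ofMeasurable (fun C _ ↦ μ (Φ.toFun (C ∩ Φ.dom)))
    (Φ.toFun_null (.inter .empty Φ.measurableSet_dom) Set.inter_subset_right (by
      rw [Set.empty_inter, measure_empty]))
    fun C hC hdisj ↦ by
      have hCdom (n : ℕ) : MeasurableSet (C n ∩ Φ.dom) := (hC n).inter Φ.measurableSet_dom
      have hsub (n : ℕ) : C n ∩ Φ.dom ⊆ Φ.dom := Set.inter_subset_right
      rw [Set.iUnion_inter, measure_congr (Φ.toFun_iUnion hCdom hsub), measure_iUnion₀]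
      · exact fun i j hij ↦ Φ.aedisjoint_toFun (hCdom i) (hsub i) (hCdom j) (hsub j)
          ((hdisj hij).mono Set.inter_subset_left Set.inter_subset_left).aedisjoint
      · exact fun i ↦ (Φ.measurableSet_toFun (hCdom i) (hsub i)).nullMeasurableSet

theorem measureComp_apply {C : Set Ω} (hC : MeasurableSet C) :
    Φ.measureComp C = μ (Φ.toFun (C ∩ Φ.dom)) :=
  Measure.ofMeasurable_apply C hC

theorem measureComp_eq_zero_iff {C : Set Ω} (hC : MeasurableSet C) :
    Φ.measureComp C = 0 ↔ μ.restrict Φ.dom C = 0 := by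
  rw [Φ.measureComp_apply hC, Φ.toFun_null_iff (hC.inter Φ.measurableSet_dom)
    Set.inter_subset_right, Measure.restrict_apply hC]

theorem isSemifinite_measureComp (hμ : IsSemifinite μ) : IsSemifinite Φ.measureComp := by
  intro A hA c hc
  have hAdom : MeasurableSet (A ∩ Φ.dom) := hA.inter Φ.measurableSet_dom
  rw [Φ.measureComp_apply hA] at hc
  obtain ⟨hΦA, hΦA'⟩ := Φ.toFun_mem _ hAdom Set.inter_subset_right
  obtain ⟨B, hBA, hB, hBfin, hcB⟩ := hμ hΦA hc
  obtain ⟨hC, hC'⟩ := Φ.invFun_mem B hB (hBA.trans hΦA')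
  have hCA : Φ.invFun B ≤ᵐ[μ] (A ∩ Φ.dom : Set Ω) :=
    (Φ.le_toFun_iff_invFun_le hAdom Set.inter_subset_right hB (hBA.trans hΦA')).1 hBA.eventuallyLE
  have hCA' : (Φ.invFun B ∩ A ∩ Φ.dom : Set Ω) =ᵐ[μ] Φ.invFun B := by
    filter_upwards [hCA] with x hx
    exact propext ⟨fun h ↦ h.1.1, fun h ↦ ⟨⟨h, (hx h).1⟩, (hx h).2⟩⟩
  have hmeas : Φ.measureComp (Φ.invFun B ∩ A) = μ B := by
    rw [Φ.measureComp_apply (hC.inter hA)]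
    exact measure_congr ((Φ.toFun_congr ((hC.inter hA).inter Φ.measurableSet_dom)
      Set.inter_subset_right hC hC' hCA').trans (Φ.toFun_invFun B hB (hBA.trans hΦA')))
  exact ⟨Φ.invFun B ∩ A, Set.inter_subset_right, hC.inter hA, hmeas ▸ hBfin, hmeas ▸ hcB⟩

end PartialSetAut

theorem isRNDeriv_indicator {Φ : PartialSetAut μ} {f : Ω → ℝ≥0} (hf : Measurable f)
    (h : Φ.symm.measureComp = (μ.restrict Φ.cod).withDensity fun x ↦ f x) :
    IsRNDeriv Φ (Φ.cod.indicator f) := by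
  refine ⟨hf.indicator Φ.measurableSet_cod, fun x hx ↦ Set.indicator_of_notMem hx f,
    fun C hC hCcod ↦ ?_⟩
  have hΦC := DFunLike.congr_fun h C
  rw [Φ.symm.measureComp_apply hC, PartialSetAut.symm_toFun, PartialSetAut.symm_dom,
    withDensity_apply _ hC, Measure.restrict_restrict hC, Set.inter_eq_left.2 hCcod] at hΦC
  rw [hΦC]
  refine setLIntegral_congr_fun hC fun x hx ↦ ?_
  rw [Set.indicator_of_mem (hCcod hx)]

theorem IsLocalizable.exists_isRNDeriv (hμ : IsLocalizable μ) (Φ : PartialSetAut μ) :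
    ∃ h : Ω → ℝ≥0, IsRNDeriv Φ h := by
  obtain ⟨f, hf, hfΦ⟩ := (hμ.restrict Φ.measurableSet_cod).exists_withDensity_eq
    (Φ.symm.isSemifinite_measureComp hμ.isSemifinite)
    (.mk fun C hC ↦ (Φ.symm.measureComp_eq_zero_iff hC).2)
    (.mk fun C hC ↦ (Φ.symm.measureComp_eq_zero_iff hC).1)
  exact ⟨_, isRNDeriv_indicator hf hfΦ⟩

end RadonNikodym

/-! ### Spatial partial isometries have contractive generalized inverses -/

section Weight

variable {Ω : Type*} [MeasurableSpace Ω] {μ : Measure Ω} {𝕜 : Type*} [RCLike 𝕜] {p : ℝ≥0∞}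

theorem eLpNorm_mul_eq_eLpNorm_withDensity {ν : Measure Ω} (hp : p ≠ 0) {h : Ω → ℝ≥0}
    (hh : Measurable h) (h0 : ∀ᵐ x ∂ν, h x ≠ 0) {a : Ω → 𝕜}
    (ha : ∀ᵐ x ∂ν, ‖a x‖ = (h x : ℝ) ^ (1 / p.toReal)) {g : Ω → 𝕜} (hg : Measurable g) :
    eLpNorm (fun x ↦ a x * g x) p ν = eLpNorm g p (ν.withDensity fun x ↦ h x) := by
  rcases eq_or_ne p ∞ with rfl | hp_top
  · have hν : ν ≪ ν.withDensity fun x ↦ h x :=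
      withDensity_absolutelyContinuous' hh.coe_nnreal_ennreal.aemeasurable (by simpa using h0)
    have hnorm : ∀ᵐ x ∂ν, ‖a x * g x‖ = ‖g x‖ := by
      filter_upwards [ha] with x hx
      rw [norm_mul, hx, ENNReal.toReal_top, div_zero, Real.rpow_zero, one_mul]
    rw [eLpNorm_congr_norm_ae hnorm, eLpNorm_exponent_top, eLpNorm_exponent_top]
    exact (eLpNormEssSup_mono_measure g hν).antisymm
      (eLpNormEssSup_mono_measure g (withDensity_absolutelyContinuous ν _))
  · have hpr : 0 < p.toReal := ENNReal.toReal_pos hp hp_top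
    rw [eLpNorm_eq_lintegral_rpow_enorm_toReal hp hp_top,
      eLpNorm_eq_lintegral_rpow_enorm_toReal hp hp_top,
      lintegral_withDensity_eq_lintegral_mul _ hh.coe_nnreal_ennreal (hg.enorm.pow_const _)]
    congr 1
    refine lintegral_congr_ae ?_
    filter_upwards [ha] with x hx
    rw [enorm_mul, ENNReal.mul_rpow_of_nonneg _ _ hpr.le, Pi.mul_apply, ← ofReal_norm (a x), hx,
      ENNReal.ofReal_rpow_of_nonneg (by positivity) hpr.le, ← Real.rpow_mul (by positivity),
      one_div_mul_cancel hpr.ne', Real.rpow_one, ENNReal.ofReal_coe_nnreal]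

theorem eLpNorm_chi_mul_le {A : Set Ω} (hA : MeasurableSet A) (f : Ω →ₘ[μ] 𝕜) :
    eLpNorm (chi μ 𝕜 A * f : Ω →ₘ[μ] 𝕜) p μ ≤ eLpNorm f p μ :=
  (eLpNorm_congr_ae (coeFn_chi_mul hA f)).trans_le (eLpNorm_indicator_le _)

theorem IsRNDeriv.ae_ne_zero {Φ : PartialSetAut μ} {h : Ω → ℝ≥0} (hh : IsRNDeriv Φ h) :
    ∀ᵐ x ∂μ, x ∈ Φ.cod → h x ≠ 0 := by
  set Z := {x | h x = 0} ∩ Φ.cod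
  have hZ : MeasurableSet Z :=
    (hh.measurable (measurableSet_singleton 0)).inter Φ.measurableSet_cod
  have hZ_null : μ (Φ.invFun Z) = 0 := by
    rw [hh.lintegral_eq Z hZ Set.inter_subset_right, setLIntegral_congr_fun (g := fun _ ↦ 0) hZ
      fun x hx ↦ ENNReal.coe_eq_zero.2 hx.1, lintegral_zero]
  filter_upwards [measure_eq_zero_iff_ae_notMem.1
    ((Φ.symm.toFun_null_iff hZ Set.inter_subset_right).1 hZ_null)] with x hx hcod h0
  exact hx ⟨h0, hcod⟩

/-- `a` is a possible weight of a spatial partial isometry of `L^p(μ)` with partial set automorphism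
`Φ`: it has modulus `(d(μ ∘ Φ*)/dμ)^{1/p}` on `D_Φ`. -/
def IsSpatialWeight (p : ℝ≥0∞) (Φ : PartialSetAut μ) (a : Ω →ₘ[μ] 𝕜) : Prop :=
  ∃ h : Ω → ℝ≥0, IsRNDeriv Φ h ∧ ∀ᵐ x ∂μ, x ∈ Φ.cod → ‖a x‖ = (h x : ℝ) ^ (1 / p.toReal)

namespace IsSpatialWeight

variable {Φ : PartialSetAut μ} {a : Ω →ₘ[μ] 𝕜}

theorem ae_ne_zero (ha : IsSpatialWeight p Φ a) : ∀ᵐ x ∂μ, x ∈ Φ.cod → a x ≠ 0 := by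
  obtain ⟨h, hh, hah⟩ := ha
  filter_upwards [hah, hh.ae_ne_zero] with x hx h0 hcod
  rw [← norm_ne_zero_iff, hx hcod]
  exact (Real.rpow_pos_of_pos (NNReal.coe_pos.2 (pos_of_ne_zero (h0 hcod))) _).ne'

theorem eLpNorm_mul_compOp (ha : IsSpatialWeight p Φ a) (hp : p ≠ 0) (f : Ω →ₘ[μ] 𝕜) :
    eLpNorm (a * compOp 𝕜 Φ f : Ω →ₘ[μ] 𝕜) p μ = eLpNorm (chi μ 𝕜 Φ.dom * f : Ω →ₘ[μ] 𝕜) p μ := by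
  obtain ⟨h, hh, hah⟩ := ha
  have hlift := isLift_compOp Φ f
  have hind : (a * compOp 𝕜 Φ f : Ω →ₘ[μ] 𝕜) =ᵐ[μ]
      Φ.cod.indicator fun x ↦ a x * compOp 𝕜 Φ f x := by
    have h := coeFn_chi_mul Φ.measurableSet_cod (a * compOp 𝕜 Φ f)
    rw [mul_left_comm, chi_cod_mul_compOp] at h
    exact h.trans (.indicator (AEEqFun.coeFn_mul _ _))
  calc eLpNorm (a * compOp 𝕜 Φ f : Ω →ₘ[μ] 𝕜) p μ
      = eLpNorm (fun x ↦ a x * compOp 𝕜 Φ f x) p (μ.restrict Φ.cod) := by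
        rw [eLpNorm_congr_ae hind, eLpNorm_indicator_eq_eLpNorm_restrict Φ.measurableSet_cod]
    _ = eLpNorm (compOp 𝕜 Φ f) p ((μ.restrict Φ.cod).withDensity fun x ↦ h x) :=
        eLpNorm_mul_eq_eLpNorm_withDensity hp hh.measurable
          ((ae_restrict_iff' Φ.measurableSet_cod).2 hh.ae_ne_zero)
          ((ae_restrict_iff' Φ.measurableSet_cod).2 hah) hlift.measurable_right
    _ = eLpNorm id p (((μ.restrict Φ.cod).withDensity fun x ↦ h x).map (compOp 𝕜 Φ f)) :=
        (eLpNorm_map_measure aestronglyMeasurable_id hlift.measurable_right.aemeasurable).symm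
    _ = eLpNorm id p ((μ.restrict Φ.dom).map f) := by rw [hlift.map_eq hh.lintegral_eq]
    _ = eLpNorm f p (μ.restrict Φ.dom) :=
        eLpNorm_map_measure aestronglyMeasurable_id hlift.measurable_left.aemeasurable
    _ = eLpNorm (chi μ 𝕜 Φ.dom * f : Ω →ₘ[μ] 𝕜) p μ := by
        rw [eLpNorm_congr_ae (coeFn_chi_mul Φ.measurableSet_dom f),
          eLpNorm_indicator_eq_eLpNorm_restrict Φ.measurableSet_dom]

end IsSpatialWeight

variable [Fact (1 ≤ p)]

theorem mem_SPIso_iff {T : Lp 𝕜 p μ →L[𝕜] Lp 𝕜 p μ} :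
    T ∈ SPIso 𝕜 p μ ↔ ∃ (Φ : PartialSetAut μ) (a : Ω →ₘ[μ] 𝕜), IsSpatialWeight p Φ a ∧
      ∀ f : Lp 𝕜 p μ, (T f : Ω →ₘ[μ] 𝕜) = a * compOp 𝕜 Φ f := by
  constructor
  · rintro ⟨Φ, V, h, ω, hV, hh, hω, hω_norm, hT⟩
    obtain rfl := hV.eq_compOp
    have hmeas : Measurable fun x ↦ ω x * (((h x : ℝ) ^ (1 / p.toReal) : ℝ) : 𝕜) :=
      hω.mul (RCLike.measurable_ofReal.comp (hh.measurable.coe_nnreal_real.pow_const _))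
    have hcoe := AEEqFun.coeFn_mk (μ := μ) _ hmeas.aestronglyMeasurable
    refine ⟨Φ, AEEqFun.mk _ hmeas.aestronglyMeasurable, ⟨h, hh, ?_⟩, fun f ↦ AEEqFun.ext ?_⟩
    · filter_upwards [hcoe] with x hx hcod
      rw [hx, norm_mul, hω_norm x hcod, one_mul, RCLike.norm_ofReal, abs_of_nonneg (by positivity)]
    · filter_upwards [hT f, hcoe, AEEqFun.coeFn_mul (AEEqFun.mk _ hmeas.aestronglyMeasurable)
        (compOp 𝕜 Φ (f : Ω →ₘ[μ] 𝕜))] with x hTx hx hmul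
      rw [hTx, hmul, Pi.mul_apply, hx]
  · classical
    rintro ⟨Φ, a, ⟨h, hh, hah⟩, hT⟩
    refine ⟨Φ, compOp 𝕜 Φ, h, fun x ↦ if a x = 0 then 1 else a x / (‖a x‖ : 𝕜),
      isCompositionOp_compOp Φ, hh, ?_, fun x _ ↦ ?_, fun f ↦ ?_⟩
    · exact .ite (a.measurable (measurableSet_singleton 0)) measurable_const
        (a.measurable.div (RCLike.measurable_ofReal.comp a.measurable.norm))
    · beta_reduce
      split_ifs with h0
      · exact norm_one
      · rw [norm_div, RCLike.norm_ofReal, abs_norm, div_self (norm_ne_zero_iff.2 h0)]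
    · rw [hT f]
      filter_upwards [hah, AEEqFun.coeFn_mul a (compOp 𝕜 Φ (f : Ω →ₘ[μ] 𝕜)),
        compOp_apply_eq_zero Φ (f : Ω →ₘ[μ] 𝕜)] with x hx hmul hzero
      rw [hmul, Pi.mul_apply]
      by_cases hcod : x ∈ Φ.cod
      · rw [← hx hcod]
        split_ifs with h0
        · rw [h0, norm_zero, RCLike.ofReal_zero, one_mul]
        · rw [div_mul_cancel₀ _ (RCLike.ofReal_ne_zero.2 (norm_ne_zero_iff.2 h0))]
      · rw [hzero hcod, mul_zero, mul_zero]

theorem exists_contraction_of_eLpNorm_le (L : (Ω →ₘ[μ] 𝕜) →ₗ[𝕜] (Ω →ₘ[μ] 𝕜))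
    (hL : ∀ f : Lp 𝕜 p μ, eLpNorm (L f) p μ ≤ eLpNorm f p μ) :
    ∃ S : Lp 𝕜 p μ →L[𝕜] Lp 𝕜 p μ, ‖S‖ ≤ 1 ∧ ∀ f : Lp 𝕜 p μ, (S f : Ω →ₘ[μ] 𝕜) = L f := by
  let S : Lp 𝕜 p μ →ₗ[𝕜] Lp 𝕜 p μ :=
    { toFun f := ⟨L f, Lp.mem_Lp_iff_eLpNorm_lt_top.2 ((hL f).trans_lt (Lp.eLpNorm_lt_top f))⟩
      map_add' f g := Subtype.ext (map_add L (f : Ω →ₘ[μ] 𝕜) g)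
      map_smul' c f := Subtype.ext (map_smul L c (f : Ω →ₘ[μ] 𝕜)) }
  have hS (f : Lp 𝕜 p μ) : ‖S f‖ ≤ 1 * ‖f‖ := by
    rw [one_mul, Lp.norm_def, Lp.norm_def]
    exact ENNReal.toReal_mono (Lp.eLpNorm_ne_top f) (hL f)
  exact ⟨S.mkContinuous 1 hS, S.mkContinuous_norm_le zero_le_one hS, fun _ ↦ rfl⟩

/-- `T` and `S` are contractive generalized inverses of each other, and the idempotents `T * S` and
`S * T` are the multiplications by the indicator functions of `D` and `D'`. -/
structure IsChiPair (T S : Lp 𝕜 p μ →L[𝕜] Lp 𝕜 p μ) (D D' : Set Ω) : Prop where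
  measurableSet_left : MeasurableSet D
  measurableSet_right : MeasurableSet D'
  norm_left_le : ‖T‖ ≤ 1
  norm_right_le : ‖S‖ ≤ 1
  mul_left : T * S = chiOp p μ 𝕜 D
  mul_right : S * T = chiOp p μ 𝕜 D'
  isGenInverse : IsGenInverse T S

theorem IsSpatialWeight.exists_isChiPair {Φ : PartialSetAut μ} {a : Ω →ₘ[μ] 𝕜}
    (ha : IsSpatialWeight p Φ a) :
    ∃ U S : Lp 𝕜 p μ →L[𝕜] Lp 𝕜 p μ, IsChiPair U S Φ.cod Φ.dom ∧
      ∀ f : Lp 𝕜 p μ, (U f : Ω →ₘ[μ] 𝕜) = a * compOp 𝕜 Φ f := by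
  have hp : p ≠ 0 := (zero_lt_one.trans_le Fact.out).ne'
  obtain ⟨b, hab⟩ := exists_mul_eq_chi Φ.measurableSet_cod ha.ae_ne_zero
  have hUS (f : Ω →ₘ[μ] 𝕜) :
      a * compOp 𝕜 Φ (compOp 𝕜 Φ.symm (b * f)) = chi μ 𝕜 Φ.cod * f := by
    rw [compOp_compOp_symm, mul_left_comm, ← mul_assoc a, hab, ← mul_assoc,
      chi_mul_self Φ.measurableSet_cod]
  have hSU (f : Ω →ₘ[μ] 𝕜) :
      compOp 𝕜 Φ.symm (b * (a * compOp 𝕜 Φ f)) = chi μ 𝕜 Φ.dom * f := by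
    rw [← mul_assoc, mul_comm b, hab, chi_cod_mul_compOp, compOp_symm_compOp]
  have hS_le (f : Lp 𝕜 p μ) : eLpNorm (compOp 𝕜 Φ.symm (b * f)) p μ ≤ eLpNorm f p μ := by
    rw [← chi_cod_mul_compOp, Φ.symm_cod, ← ha.eLpNorm_mul_compOp hp, hUS]
    exact eLpNorm_chi_mul_le Φ.measurableSet_cod _
  have hU_le (f : Lp 𝕜 p μ) : eLpNorm (a * compOp 𝕜 Φ f : Ω →ₘ[μ] 𝕜) p μ ≤ eLpNorm f p μ :=
    (ha.eLpNorm_mul_compOp hp f).trans_le (eLpNorm_chi_mul_le Φ.measurableSet_dom _)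
  obtain ⟨U, hU, hUa⟩ : ∃ U : Lp 𝕜 p μ →L[𝕜] Lp 𝕜 p μ, ‖U‖ ≤ 1 ∧
      ∀ f : Lp 𝕜 p μ, (U f : Ω →ₘ[μ] 𝕜) = a * compOp 𝕜 Φ f :=
    exists_contraction_of_eLpNorm_le (LinearMap.mulLeft 𝕜 a ∘ₗ compOp 𝕜 Φ) hU_le
  obtain ⟨S, hS, hSb⟩ : ∃ S : Lp 𝕜 p μ →L[𝕜] Lp 𝕜 p μ, ‖S‖ ≤ 1 ∧
      ∀ f : Lp 𝕜 p μ, (S f : Ω →ₘ[μ] 𝕜) = compOp 𝕜 Φ.symm (b * f) :=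
    exists_contraction_of_eLpNorm_le (compOp 𝕜 Φ.symm ∘ₗ LinearMap.mulLeft 𝕜 b) hS_le
  have hmul_left : U * S = chiOp p μ 𝕜 Φ.cod := ContinuousLinearMap.ext fun f ↦ Subtype.ext <| by
    rw [mul_apply_eq_comp, hUa, hSb, hUS, coe_chiOp]
  have hmul_right : S * U = chiOp p μ 𝕜 Φ.dom := ContinuousLinearMap.ext fun f ↦ Subtype.ext <| by
    rw [mul_apply_eq_comp, hSb, hUa, hSU, coe_chiOp]
  refine ⟨U, S, ⟨Φ.measurableSet_cod, Φ.measurableSet_dom, hU, hS, hmul_left, hmul_right,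
    ContinuousLinearMap.ext fun f ↦ Subtype.ext ?_,
    ContinuousLinearMap.ext fun f ↦ Subtype.ext ?_⟩, hUa⟩
  · rw [hmul_left, mul_apply_eq_comp, coe_chiOp, hUa, mul_left_comm, chi_cod_mul_compOp]
  · rw [hmul_right, mul_apply_eq_comp, coe_chiOp, hSb, ← Φ.symm_cod, chi_cod_mul_compOp]

theorem exists_isChiPair_of_mem_SPIso {T : Lp 𝕜 p μ →L[𝕜] Lp 𝕜 p μ} (hT : T ∈ SPIso 𝕜 p μ) :
    ∃ S D D', IsChiPair T S D D' := by
  obtain ⟨Φ, a, ha, hTa⟩ := mem_SPIso_iff.1 hT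
  obtain ⟨U, S, hU, hUa⟩ := ha.exists_isChiPair
  obtain rfl : U = T := ContinuousLinearMap.ext fun f ↦ Subtype.ext <| by rw [hUa, hTa]
  exact ⟨S, _, _, hU⟩

end Weight

/-! ### The commutant of the multiplication operators -/

section Commutant

variable {Ω : Type*} [MeasurableSpace Ω] {μ : Measure Ω} {𝕜 : Type*} [RCLike 𝕜] {p : ℝ≥0∞}

theorem IsSemifinite.measure_eq_zero_of_forall_chi_mul (hμ : IsSemifinite μ) {C : Set Ω}
    (hC : MeasurableSet C) (h : ∀ f : Lp 𝕜 p μ, chi μ 𝕜 C * (f : Ω →ₘ[μ] 𝕜) = 0) : μ C = 0 := by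
  by_contra hne
  obtain ⟨B, hBC, hB, hBfin, hBpos⟩ := hμ hC (pos_iff_ne_zero.2 hne)
  refine hBpos.ne' (measure_eq_zero_iff_ae_notMem.2 ?_)
  filter_upwards [(chi_mul_eq_zero_iff hC).1 (h (indicatorConstLp p hB hBfin.ne 1)),
    indicatorConstLp_coeFn_mem (p := p) (hs := hB) (hμs := hBfin.ne) (c := (1 : 𝕜))]
    with x hzero hone hx
  exact one_ne_zero ((hone hx).symm.trans (hzero (hBC hx)))

theorem exists_simpleFunc_dist_le {E : Type*} [PseudoMetricSpace E] [MeasurableSpace E]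
    [OpensMeasurableSpace E] [TopologicalSpace.SeparableSpace E] [Nonempty E] {K : Set E}
    (hK : IsCompact K) {k : Ω → E} (hk : Measurable k) {ε : ℝ} (hε : 0 < ε) :
    ∃ s : SimpleFunc Ω E, ∀ x, k x ∈ K → dist (s x) (k x) ≤ ε := by
  let e := TopologicalSpace.denseSeq E
  have hcover : K ⊆ ⋃ n, Metric.ball (e n) ε := fun y _ ↦ by
    obtain ⟨n, hn⟩ := (TopologicalSpace.denseRange_denseSeq E).exists_dist_lt y hε
    exact Set.mem_iUnion.2 ⟨n, hn⟩
  obtain ⟨t, ht⟩ := hK.elim_finite_subcover _ (fun n ↦ Metric.isOpen_ball) hcover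
  refine ⟨(SimpleFunc.nearestPt e (t.sup id)).comp k hk, fun x hx ↦ ?_⟩
  obtain ⟨n, hn, hxn⟩ := Set.mem_iUnion₂.1 (ht hx)
  have hle := SimpleFunc.edist_nearestPt_le e (k x) (Finset.le_sup (f := id) hn)
  rw [edist_dist, edist_dist, ENNReal.ofReal_le_ofReal_iff dist_nonneg] at hle
  exact hle.trans (dist_comm (e n) (k x) ▸ (Metric.mem_ball.1 hxn).le)

theorem mem_span_chiTop_of_coe_eq_mk {g : Lp 𝕜 ∞ μ} {s : SimpleFunc Ω 𝕜}
    (hg : (g : Ω →ₘ[μ] 𝕜) = AEEqFun.mk s s.aestronglyMeasurable) :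
    g ∈ Submodule.span 𝕜 {k : Lp 𝕜 ∞ μ | ∃ A, MeasurableSet A ∧ k = chiTop μ 𝕜 A} := by
  let coeHom : Lp 𝕜 ∞ μ →ₗ[𝕜] (Ω →ₘ[μ] 𝕜) := (Lp.LpSubmodule 𝕜 𝕜 ∞ μ).subtype
  have himage : {f : Ω →ₘ[μ] 𝕜 | ∃ A, MeasurableSet A ∧ f = chi μ 𝕜 A} =
      coeHom '' {k : Lp 𝕜 ∞ μ | ∃ A, MeasurableSet A ∧ k = chiTop μ 𝕜 A} := by
    ext f
    constructor
    · rintro ⟨A, hA, rfl⟩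
      exact ⟨chiTop μ 𝕜 A, ⟨A, hA, rfl⟩, rfl⟩
    · rintro ⟨_, ⟨A, hA, rfl⟩, rfl⟩
      exact ⟨A, hA, rfl⟩
  have hmem := mk_simpleFunc_mem_span_chi (μ := μ) s
  rw [himage, ← Submodule.map_span, ← hg] at hmem
  obtain ⟨k, hk, hkg⟩ := hmem
  rwa [← Subtype.ext (hkg : (k : Ω →ₘ[μ] 𝕜) = g)]

theorem dense_span_chiTop :
    Dense (Submodule.span 𝕜 {k : Lp 𝕜 ∞ μ | ∃ A, MeasurableSet A ∧ k = chiTop μ 𝕜 A} :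
      Set (Lp 𝕜 ∞ μ)) := by
  refine Metric.dense_iff.2 fun g ε hε ↦ ?_
  obtain ⟨s, hs⟩ := exists_simpleFunc_dist_le (isCompact_closedBall (0 : 𝕜) ‖g‖)
    (Lp.stronglyMeasurable g).measurable (half_pos hε)
  have hdist : ∀ᵐ x ∂μ, ‖((AEEqFun.mk s s.aestronglyMeasurable : Ω →ₘ[μ] 𝕜) - g) x‖ ≤ ε / 2 := by
    filter_upwards [ae_norm_le_norm g, AEEqFun.coeFn_mk s s.aestronglyMeasurable,
      AEEqFun.coeFn_sub (AEEqFun.mk s s.aestronglyMeasurable : Ω →ₘ[μ] 𝕜) g] with x hg hmk hsub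
    rw [hsub, Pi.sub_apply, hmk, ← dist_eq_norm]
    exact hs x (mem_closedBall_zero_iff.2 hg)
  let d : Lp 𝕜 ∞ μ := ⟨_, mem_Lp_top_of_ae_norm_le hdist⟩
  refine ⟨g + d, ?_, mem_span_chiTop_of_coe_eq_mk (s := s) ?_⟩
  · rw [Metric.mem_ball, dist_eq_norm, add_sub_cancel_left]
    exact (norm_le_of_ae_norm_le (half_pos hε).le hdist).trans_lt (half_lt_self hε)
  · exact add_sub_cancel (g : Ω →ₘ[μ] 𝕜) _

theorem exists_mul_eq_chi_mul {A : Set Ω} (hA : MeasurableSet A) {f g : Ω →ₘ[μ] 𝕜}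
    (hfg : ∀ᵐ x ∂μ, x ∈ A → ‖f x‖ ≤ ‖g x‖) :
    ∃ k : Lp 𝕜 ∞ μ, (k : Ω →ₘ[μ] 𝕜) * g = chi μ 𝕜 A * f := by
  let k : Ω →ₘ[μ] 𝕜 := AEEqFun.mk (A.indicator fun x ↦ f x / g x)
    ((f.measurable.div g.measurable).indicator hA).aestronglyMeasurable
  have hk : k =ᵐ[μ] A.indicator fun x ↦ f x / g x := AEEqFun.coeFn_mk _ _
  have hk_le : ∀ᵐ x ∂μ, ‖k x‖ ≤ 1 := by
    filter_upwards [hfg, hk] with x hle hkx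
    rw [hkx]
    by_cases hx : x ∈ A
    · rw [Set.indicator_of_mem hx, norm_div]
      exact div_le_one_of_le₀ (hle hx) (norm_nonneg _)
    · rw [Set.indicator_of_notMem hx, norm_zero]
      exact zero_le_one
  refine ⟨⟨k, mem_Lp_top_of_ae_norm_le hk_le⟩, AEEqFun.ext ?_⟩
  filter_upwards [hfg, hk, AEEqFun.coeFn_mul k g, coeFn_chi_mul hA f] with x hle hkx hmul hchi
  rw [hmul, hchi, Pi.mul_apply, hkx]
  by_cases hx : x ∈ A
  · rw [Set.indicator_of_mem hx, Set.indicator_of_mem hx]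
    exact div_mul_cancel_of_imp fun hgx ↦
      norm_le_zero_iff.1 ((hle hx).trans_eq (norm_eq_zero.2 hgx))
  · rw [Set.indicator_of_notMem hx, Set.indicator_of_notMem hx, zero_mul]

theorem IsLocalizable.exists_forall_eq_mul (hμ : IsLocalizable μ) {ι : Type*}
    {u v : ι → Ω →ₘ[μ] 𝕜} (huv : ∀ i j, u i * v j = u j * v i)
    (hsupp : ∀ i, chi μ 𝕜 (suppSet (v i)) * u i = u i) : ∃ w, ∀ i, u i = w * v i := by
  obtain ⟨w, hw, hwA⟩ := hμ.exists_glue (fun i ↦ measurableSet_suppSet (v i))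
    (f := fun i x ↦ u i x / v i x) (fun i ↦ (u i).measurable.div (v i).measurable) fun i j ↦ by
      filter_upwards [AEEqFun.coeFn_mul (u i) (v j), AEEqFun.coeFn_mul (u j) (v i)]
        with x hij hji hi hj
      rw [huv, hji] at hij
      exact (div_eq_div_iff hi hj).2 hij.symm
  refine ⟨AEEqFun.mk w hw.aestronglyMeasurable, fun i ↦ AEEqFun.ext ?_⟩
  have hsupp_i := (measure_suppSet_diff_eq_zero_iff (measurableSet_suppSet (v i))).2 (hsupp i)
  filter_upwards [measure_eq_zero_iff_ae_notMem.1 hsupp_i, hwA i,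
    AEEqFun.coeFn_mk w hw.aestronglyMeasurable,
    AEEqFun.coeFn_mul (AEEqFun.mk w hw.aestronglyMeasurable) (v i)] with x hx hwx hmk hmul
  rw [hmul, Pi.mul_apply, hmk]
  by_cases hv : v i x = 0
  · rw [hv, mul_zero]
    by_contra hu
    exact hx ⟨hu, fun h ↦ h hv⟩
  · rw [hwx hv, div_mul_cancel₀ _ hv]

variable [Fact (1 ≤ p)] {T : Lp 𝕜 p μ →L[𝕜] Lp 𝕜 p μ}

theorem IsSemifinite.chiOp_mul_chiOp_eq_iff (hμ : IsSemifinite μ) {A B : Set Ω}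
    (hA : MeasurableSet A) (hB : MeasurableSet B) :
    chiOp p μ 𝕜 B * chiOp p μ 𝕜 A = chiOp p μ 𝕜 A ↔ μ (A \ B) = 0 := by
  constructor
  · refine fun h ↦ hμ.measure_eq_zero_of_forall_chi_mul (hA.diff hB) fun f : Lp 𝕜 p μ ↦ ?_
    have hf := congrArg Subtype.val (DFunLike.congr_fun h f)
    simp only [mul_apply_eq_comp, coe_chiOp] at hf
    rw [Set.sdiff_eq, ← chi_mul_chi hA hB.compl, chi_compl hB]
    linear_combination -hf
  · intro h
    have hle : A ≤ᵐ[μ] B := ae_le_set.2 h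
    refine ContinuousLinearMap.ext fun f ↦ Subtype.ext ?_
    rw [mul_apply_eq_comp, coe_chiOp, coe_chiOp, ← mul_assoc, chi_mul_chi hB hA,
      chi_congr (hB.inter hA) hA (Filter.eventuallyEq_set.2 (hle.mono fun x hx ↦
        ⟨And.right, fun hxA ↦ ⟨hx hxA, hxA⟩⟩))]

theorem IsSemifinite.ae_norm_le_opNorm (hμ : IsSemifinite μ) {w : Ω →ₘ[μ] 𝕜}
    (hT : ∀ f : Lp 𝕜 p μ, (T f : Ω →ₘ[μ] 𝕜) = w * f) : ∀ᵐ x ∂μ, ‖w x‖ ≤ ‖T‖ := by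
  suffices h : ∀ c, ‖T‖ < c → ∀ᵐ x ∂μ, ‖w x‖ ≤ c by
    filter_upwards [ae_all_iff.2 fun n : ℕ ↦ h (‖T‖ + 1 / (n + 1))
      (lt_add_of_pos_right _ Nat.one_div_pos_of_nat)] with x hx
    refine le_of_forall_pos_le_add fun ε hε ↦ ?_
    obtain ⟨n, hn⟩ := exists_nat_one_div_lt hε
    exact (hx n).trans (by gcongr)
  intro c hc
  have hc0 : 0 ≤ c := (norm_nonneg T).trans hc.le
  set A := {x | c < ‖w x‖}
  have hA : MeasurableSet A := measurableSet_lt measurable_const w.measurable.norm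
  suffices h : ∀ f : Lp 𝕜 p μ, chiOp p μ 𝕜 A f = 0 from
    (measure_eq_zero_iff_ae_notMem.1 (hμ.measure_eq_zero_of_forall_chi_mul hA fun f : Lp 𝕜 p μ ↦
      (coe_chiOp A f).symm.trans (congrArg Subtype.val (h f)))).mono fun x hx ↦ not_lt.1 hx
  intro f
  set g := chiOp p μ 𝕜 A f with hg
  have hTg : T g =ᵐ[μ] (w * (g : Ω →ₘ[μ] 𝕜) : Ω →ₘ[μ] 𝕜) := by rw [← hT]
  have hle : c * ‖g‖ ≤ ‖T g‖ := by
    rw [← RCLike.norm_of_nonneg (K := 𝕜) hc0, ← norm_smul]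
    refine Lp.norm_le_norm_of_ae_le ?_
    filter_upwards [Lp.coeFn_smul (c : 𝕜) g, hTg, AEEqFun.coeFn_mul w g,
      coeFn_chi_mul hA (f : Ω →ₘ[μ] 𝕜)] with x hsmul hTx hmul hchi
    rw [hsmul, hTx, hmul, Pi.smul_apply, Pi.mul_apply, norm_smul, norm_mul,
      RCLike.norm_of_nonneg hc0, hg, coe_chiOp, hchi]
    by_cases hx : x ∈ A
    · have hcw : c < ‖w x‖ := hx
      gcongr
    · rw [Set.indicator_of_notMem hx, norm_zero, mul_zero, mul_zero]
  refine norm_le_zero_iff.1 (not_lt.1 fun hpos ↦ ?_)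
  exact (mul_lt_mul_of_pos_right hc hpos).not_ge (hle.trans (T.le_opNorm g))

theorem isMultiplicationOp_of_mul_comm (hμ : IsLocalizable μ)
    (h : ∀ f g : Lp 𝕜 p μ, (T f : Ω →ₘ[μ] 𝕜) * g = f * T g) : IsMultiplicationOp T := by
  obtain ⟨w, hw⟩ := hμ.exists_forall_eq_mul (u := fun f : Lp 𝕜 p μ ↦ (T f : Ω →ₘ[μ] 𝕜))
    (v := fun f ↦ (f : Ω →ₘ[μ] 𝕜)) (fun f g ↦ (h f g).trans (mul_comm _ _)) fun f ↦ by
      refine (measure_suppSet_diff_eq_zero_iff (measurableSet_suppSet _)).1 ?_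
      refine measure_eq_zero_iff_ae_notMem.2 ?_
      filter_upwards [AEEqFun.coeFn_mul (T f : Ω →ₘ[μ] 𝕜) (T f),
        AEEqFun.coeFn_mul (f : Ω →ₘ[μ] 𝕜) (T (T f))] with x hTT hfT hx
      rw [h f (T f), hfT, Pi.mul_apply, Pi.mul_apply, not_not.1 hx.2, zero_mul] at hTT
      exact hx.1 (mul_self_eq_zero.1 hTT.symm)
  refine ⟨⟨w, mem_Lp_top_of_ae_norm_le (hμ.isSemifinite.ae_norm_le_opNorm hw)⟩, fun f ↦ ?_⟩
  have hTf : T f =ᵐ[μ] (w * (f : Ω →ₘ[μ] 𝕜) : Ω →ₘ[μ] 𝕜) := by rw [← hw]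
  exact hTf.trans (AEEqFun.coeFn_mul _ _)

theorem commute_mulOp_of_commute_chiOp
    (h : ∀ A, MeasurableSet A → Commute T (chiOp p μ 𝕜 A)) (g : Lp 𝕜 ∞ μ) :
    Commute T (mulOp p g) := by
  have heq : (ContinuousLinearMap.mul 𝕜 _ T).comp (mulOp p (𝕜 := 𝕜) (μ := μ)) =
      ((ContinuousLinearMap.mul 𝕜 _).flip T).comp (mulOp p) := by
    refine ContinuousLinearMap.ext_on dense_span_chiTop ?_
    rintro _ ⟨A, hA, rfl⟩
    exact h A hA
  exact DFunLike.congr_fun heq g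

theorem isMultiplicationOp_of_commute_chiOp (hμ : IsLocalizable μ)
    (h : ∀ A, MeasurableSet A → Commute T (chiOp p μ 𝕜 A)) : IsMultiplicationOp T := by
  have hmul (k : Lp 𝕜 ∞ μ) (g : Lp 𝕜 p μ) :
      (T (mulOp p k g) : Ω →ₘ[μ] 𝕜) = k * (T g : Ω →ₘ[μ] 𝕜) := by
    rw [← coe_mulOp]
    exact congrArg Subtype.val (DFunLike.congr_fun (commute_mulOp_of_commute_chiOp h k) g)
  have hlocal {A : Set Ω} (hA : MeasurableSet A) {f g : Lp 𝕜 p μ}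
      (hfg : ∀ᵐ x ∂μ, x ∈ A → ‖f x‖ ≤ ‖g x‖) :
      chi μ 𝕜 A * ((T f : Ω →ₘ[μ] 𝕜) * g) = chi μ 𝕜 A * (f * (T g : Ω →ₘ[μ] 𝕜)) := by
    obtain ⟨k, hk⟩ := exists_mul_eq_chi_mul hA (f := (f : Ω →ₘ[μ] 𝕜)) hfg
    have hTf : chi μ 𝕜 A * (T f : Ω →ₘ[μ] 𝕜) = k * (T g : Ω →ₘ[μ] 𝕜) := by
      rw [← hmul, ← (Subtype.ext (by rw [coe_chiOp, coe_mulOp, hk]) :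
        chiOp p μ 𝕜 A f = mulOp p k g)]
      exact (hmul (chiTop μ 𝕜 A) f).symm
    rw [← mul_assoc, ← mul_assoc, hTf, ← hk]
    ring
  refine isMultiplicationOp_of_mul_comm hμ fun f g ↦ ?_
  have hA : MeasurableSet {x | ‖f x‖ ≤ ‖g x‖} :=
    measurableSet_le (Lp.stronglyMeasurable f).measurable.norm
      (Lp.stronglyMeasurable g).measurable.norm
  have hle := hlocal hA (f := f) (g := g) (.of_forall fun x hx ↦ hx)
  have hge := hlocal hA.compl (f := g) (g := f) (.of_forall fun x hx ↦
    (not_le.1 (Set.notMem_ofPred_iff.1 hx)).le)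
  rw [chi_compl hA] at hge
  linear_combination hle - hge

end Commutant

/-! ### `L^p`-projections on `L^p(μ)` -/

section ClarksonDefect

theorem add_rpow_lt_rpow_add_rpow {a b s : ℝ} (ha : 0 < a) (hb : 0 < b) (hs : s < 1) :
    (a + b) ^ s < a ^ s + b ^ s := by
  have hsplit (x : ℝ) (hx : 0 < x) : x ^ s = x * x ^ (s - 1) := by
    rw [Real.rpow_sub_one hx.ne', mul_div_cancel₀ _ hx.ne']
  have hlt_a : (a + b) ^ (s - 1) < a ^ (s - 1) :=
    Real.rpow_lt_rpow_of_neg ha (lt_add_of_pos_right a hb) (sub_neg.2 hs)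
  have hlt_b : (a + b) ^ (s - 1) < b ^ (s - 1) :=
    Real.rpow_lt_rpow_of_neg hb (lt_add_of_pos_left b ha) (sub_neg.2 hs)
  rw [hsplit _ (add_pos ha hb), hsplit a ha, hsplit b hb, add_mul]
  gcongr

theorem rpow_add_rpow_lt_add_rpow {a b s : ℝ} (ha : 0 < a) (hb : 0 < b) (hs : 1 < s) :
    a ^ s + b ^ s < (a + b) ^ s := by
  have hsplit (x : ℝ) (hx : 0 < x) : x ^ s = x * x ^ (s - 1) := by
    rw [Real.rpow_sub_one hx.ne', mul_div_cancel₀ _ hx.ne']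
  have hlt_a : a ^ (s - 1) < (a + b) ^ (s - 1) :=
    Real.rpow_lt_rpow ha.le (lt_add_of_pos_right a hb) (sub_pos.2 hs)
  have hlt_b : b ^ (s - 1) < (a + b) ^ (s - 1) :=
    Real.rpow_lt_rpow hb.le (lt_add_of_pos_left b ha) (sub_pos.2 hs)
  rw [hsplit _ (add_pos ha hb), hsplit a ha, hsplit b hb, add_mul]
  gcongr

variable {E : Type*} [NormedAddCommGroup E]

/-- The defect in Clarkson's inequality with exponent `r`. In an inner product space it vanishes
for `r = 2`, and for other positive `r` it has a constant sign. -/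
def clarksonDefect (r : ℝ) (z w : E) : ℝ :=
  2 * (‖z‖ ^ r + ‖w‖ ^ r) - (‖z + w‖ ^ r + ‖z - w‖ ^ r)

theorem clarksonDefect_eq_zero {r : ℝ} (hr : r ≠ 0) {z w : E} (h : z = 0 ∨ w = 0) :
    clarksonDefect r z w = 0 := by
  rcases h with rfl | rfl <;> simp [clarksonDefect, Real.zero_rpow hr, two_mul]

theorem norm_rpow_eq_sq_rpow (z : E) (r : ℝ) : ‖z‖ ^ r = (‖z‖ ^ 2) ^ (r / 2) := by
  rw [← Real.rpow_natCast, ← Real.rpow_mul (norm_nonneg z), Nat.cast_ofNat,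
    mul_div_cancel₀ _ two_ne_zero]

variable (𝕜 : Type*) [RCLike 𝕜] [InnerProductSpace 𝕜 E]

include 𝕜 in
theorem clarksonDefect_pos {r : ℝ} (hr : 0 < r) (hr2 : r < 2) {z w : E} (hz : z ≠ 0)
    (hw : w ≠ 0) : 0 < clarksonDefect r z w := by
  have hparallelogram := parallelogram_law_with_norm 𝕜 z w
  have hconcave := (Real.concaveOn_rpow (p := r / 2) (by linarith) (by linarith)).2
    (Set.mem_Ici.2 (sq_nonneg ‖z + w‖)) (Set.mem_Ici.2 (sq_nonneg ‖z - w‖))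
    one_half_pos.le one_half_pos.le (add_halves 1)
  have hmean : (1 / 2 : ℝ) • ‖z + w‖ ^ 2 + (1 / 2 : ℝ) • ‖z - w‖ ^ 2 = ‖z‖ ^ 2 + ‖w‖ ^ 2 := by
    simp only [smul_eq_mul]
    linarith
  have hsubadditive := add_rpow_lt_rpow_add_rpow (s := r / 2) (pow_pos (norm_pos_iff.2 hz) 2)
    (pow_pos (norm_pos_iff.2 hw) 2) (by linarith)
  rw [hmean] at hconcave
  simp only [smul_eq_mul, ← norm_rpow_eq_sq_rpow] at hconcave hsubadditive
  rw [clarksonDefect]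
  linarith

include 𝕜 in
theorem clarksonDefect_neg {r : ℝ} (hr2 : 2 < r) {z w : E} (hz : z ≠ 0) (hw : w ≠ 0) :
    clarksonDefect r z w < 0 := by
  have hparallelogram := parallelogram_law_with_norm 𝕜 z w
  have hconvex := (convexOn_rpow (p := r / 2) (by linarith)).2
    (Set.mem_Ici.2 (sq_nonneg ‖z + w‖)) (Set.mem_Ici.2 (sq_nonneg ‖z - w‖))
    one_half_pos.le one_half_pos.le (add_halves 1)
  have hmean : (1 / 2 : ℝ) • ‖z + w‖ ^ 2 + (1 / 2 : ℝ) • ‖z - w‖ ^ 2 = ‖z‖ ^ 2 + ‖w‖ ^ 2 := by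
    simp only [smul_eq_mul]
    linarith
  have hsuperadditive := rpow_add_rpow_lt_add_rpow (s := r / 2)
    (pow_pos (norm_pos_iff.2 hz) 2) (pow_pos (norm_pos_iff.2 hw) 2) (by linarith)
  rw [hmean] at hconvex
  simp only [smul_eq_mul, ← norm_rpow_eq_sq_rpow] at hconvex hsuperadditive
  rw [clarksonDefect]
  linarith

include 𝕜 in
theorem exists_mul_clarksonDefect_nonneg {r : ℝ} (hr : 0 < r) (hr2 : r ≠ 2) :
    ∃ ε : ℝ, ∀ z w : E, 0 ≤ ε * clarksonDefect r z w ∧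
      (ε * clarksonDefect r z w = 0 → z = 0 ∨ w = 0) := by
  suffices h : ∃ ε : ℝ, ∀ z w : E, z ≠ 0 → w ≠ 0 → 0 < ε * clarksonDefect r z w by
    obtain ⟨ε, hε⟩ := h
    refine ⟨ε, fun z w ↦ ?_⟩
    by_cases hzw : z = 0 ∨ w = 0
    · simp [clarksonDefect_eq_zero hr.ne' hzw, hzw]
    · obtain ⟨hz, hw⟩ := not_or.1 hzw
      exact ⟨(hε z w hz hw).le, fun h ↦ absurd h (hε z w hz hw).ne'⟩
  rcases hr2.lt_or_gt with hlt | hgt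
  · exact ⟨1, fun z w hz hw ↦ by simpa using clarksonDefect_pos 𝕜 hr hlt hz hw⟩
  · exact ⟨-1, fun z w hz hw ↦ by simpa using clarksonDefect_neg 𝕜 hgt hz hw⟩

end ClarksonDefect

section LpProjection

variable {Ω 𝕜 : Type*} [MeasurableSpace Ω] {μ : Measure Ω} [RCLike 𝕜] {p : ℝ≥0∞} [Fact (1 ≤ p)]

theorem norm_rpow_eq_integral {E : Type*} [NormedAddCommGroup E] (hpt : p ≠ ∞) (f : Lp E p μ) :
    ‖f‖ ^ p.toReal = ∫ x, ‖f x‖ ^ p.toReal ∂μ := by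
  have hp0 : p ≠ 0 := (zero_lt_one.trans_le (Fact.out : 1 ≤ p)).ne'
  have hpr : 0 < p.toReal := ENNReal.toReal_pos hp0 hpt
  have hnonneg : 0 ≤ ∫ x, ‖f x‖ ^ p.toReal ∂μ := integral_nonneg fun x ↦ by positivity
  rw [Lp.norm_def, (Lp.memLp f).eLpNorm_eq_integral_rpow_norm hp0 hpt,
    ENNReal.toReal_ofReal (by positivity), ← Real.rpow_mul hnonneg, inv_mul_cancel₀ hpr.ne',
    Real.rpow_one]

theorem integrable_clarksonDefect {E : Type*} [NormedAddCommGroup E] (hpt : p ≠ ∞)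
    (f g : Lp E p μ) :
    Integrable (fun x ↦ clarksonDefect p.toReal (f x) (g x)) μ ∧
      ∫ x, clarksonDefect p.toReal (f x) (g x) ∂μ = clarksonDefect p.toReal f g := by
  have hint (f : Lp E p μ) : Integrable (fun x ↦ ‖f x‖ ^ p.toReal) μ :=
    (Lp.memLp f).integrable_norm_rpow (zero_lt_one.trans_le (Fact.out : 1 ≤ p)).ne' hpt
  have hae : (fun x ↦ 2 * (‖f x‖ ^ p.toReal + ‖g x‖ ^ p.toReal) -
      (‖(f + g) x‖ ^ p.toReal + ‖(f - g) x‖ ^ p.toReal)) =ᵐ[μ]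
      fun x ↦ clarksonDefect p.toReal (f x) (g x) := by
    filter_upwards [Lp.coeFn_add f g, Lp.coeFn_sub f g] with x hadd hsub
    rw [hadd, hsub]
    rfl
  have hint_mean : Integrable (fun x ↦ 2 * (‖f x‖ ^ p.toReal + ‖g x‖ ^ p.toReal)) μ :=
    ((hint f).add (hint g)).const_mul 2
  have hint_par : Integrable (fun x ↦ ‖(f + g) x‖ ^ p.toReal + ‖(f - g) x‖ ^ p.toReal) μ :=
    (hint (f + g)).add (hint (f - g))
  refine ⟨(hint_mean.sub hint_par).congr hae, ?_⟩
  rw [← integral_congr_ae hae, integral_sub hint_mean hint_par, integral_const_mul,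
    integral_add (hint f) (hint g), integral_add (hint _) (hint _)]
  simp only [← norm_rpow_eq_integral hpt]
  rfl

theorem mul_eq_zero_of_clarksonDefect_eq_zero (hp2 : p ≠ 2) (hpt : p ≠ ∞) {f g : Lp 𝕜 p μ}
    (h : clarksonDefect p.toReal f g = 0) : (f : Ω →ₘ[μ] 𝕜) * g = 0 := by
  have hpr : 0 < p.toReal :=
    ENNReal.toReal_pos (zero_lt_one.trans_le (Fact.out : 1 ≤ p)).ne' hpt
  have hpr2 : p.toReal ≠ 2 := fun h2 ↦ hp2 (by rw [← ENNReal.ofReal_toReal hpt, h2]; norm_num)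
  obtain ⟨ε, hε⟩ := exists_mul_clarksonDefect_nonneg (E := 𝕜) 𝕜 hpr hpr2
  obtain ⟨hint, hintegral⟩ := integrable_clarksonDefect hpt f g
  have hzero : ∫ x, ε * clarksonDefect p.toReal (f x) (g x) ∂μ = 0 := by
    rw [integral_const_mul, hintegral, h, mul_zero]
  have hae := (integral_eq_zero_iff_of_nonneg (fun x ↦ (hε (f x) (g x)).1)
    (hint.const_mul ε)).1 hzero
  refine mul_eq_zero_iff_ae.2 ?_
  filter_upwards [hae] with x hx using (hε (f x) (g x)).2 hx

theorem IsLpProjection.isMultiplicationOp_of_ne_top (hμ : IsLocalizable μ) (hp2 : p ≠ 2)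
    (hpt : p ≠ ∞) {P : Lp 𝕜 p μ →L[𝕜] Lp 𝕜 p μ} (hP : IsLpProjection p P) :
    IsMultiplicationOp P := by
  obtain ⟨hidem, hnorm, -⟩ := hP
  have hPP (f : Lp 𝕜 p μ) : P (P f) = P f := congrArg (· f) hidem
  have hdisjoint (f g : Lp 𝕜 p μ) : (P f : Ω →ₘ[μ] 𝕜) * (g - P g : Lp 𝕜 p μ) = 0 := by
    refine mul_eq_zero_of_clarksonDefect_eq_zero hp2 hpt ?_
    have hadd := hnorm hpt (P f + (g - P g))
    have hsub := hnorm hpt (P f - (g - P g))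
    simp only [map_add, map_sub, hPP, sub_self, add_zero, sub_zero, add_sub_cancel_left,
      sub_sub_cancel_left, norm_neg] at hadd hsub
    rw [clarksonDefect, hadd, hsub]
    ring
  refine isMultiplicationOp_of_mul_comm hμ fun f g ↦ ?_
  have hfg := hdisjoint f g
  have hgf := hdisjoint g f
  rw [AddSubgroupClass.coe_sub, mul_sub, sub_eq_zero] at hfg hgf
  rw [hfg, mul_comm, ← hgf, mul_comm]

theorem eq_norm_of_norm_add_norm_one_sub_le {a : 𝕜} (h : ‖a‖ + ‖1 - a‖ ≤ 1) : a = ‖a‖ := by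
  have hre := RCLike.re_le_norm (1 - a)
  rw [map_sub, RCLike.one_re] at hre
  have hle : ‖a‖ ≤ RCLike.re a := by linarith
  rw [le_antisymm hle (RCLike.re_le_norm a), RCLike.re_eq_self_of_le hle]

theorem exists_norm_add_mul_eq (a b : 𝕜) : ∃ c : 𝕜, ‖c‖ = 1 ∧ ‖a + c * b‖ = ‖a‖ + ‖b‖ := by
  obtain ⟨u, hu, hua⟩ := RCLike.exists_norm_mul_eq_self a
  obtain ⟨v, hv, hvb⟩ := RCLike.exists_norm_eq_mul_self b
  refine ⟨u * v, by rw [norm_mul, hu, hv, one_mul], ?_⟩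
  have hphase : a + u * v * b = u * ((‖a‖ + ‖b‖ : ℝ) : 𝕜) := by
    rw [mul_assoc, ← hvb, RCLike.ofReal_add, mul_add, hua]
  rw [hphase, norm_mul, hu, one_mul, RCLike.norm_ofReal, abs_of_nonneg (by positivity)]

theorem eq_mul_of_norm_add_norm_sub_le {a v z : 𝕜} (hv : ‖v‖ = 1) (hz : ‖z‖ + ‖1 - a‖ ≤ 1)
    (ha : ‖a‖ + ‖v - z‖ ≤ 1) : z = a * v := by
  have hv0 : v ≠ 0 := norm_ne_zero_iff.1 (hv.trans_ne one_ne_zero)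
  obtain ⟨y, rfl⟩ : ∃ y, z = y * v := ⟨z / v, (div_mul_cancel₀ z hv0).symm⟩
  have hsub : v - y * v = (1 - y) * v := by ring
  rw [hsub] at ha
  rw [norm_mul, hv, mul_one] at ha hz
  have htriangle (b : 𝕜) : 1 ≤ ‖b‖ + ‖1 - b‖ := by
    simpa using norm_add_le b (1 - b)
  have ha' := eq_norm_of_norm_add_norm_one_sub_le (a := a) (by linarith [htriangle y])
  have hy' := eq_norm_of_norm_add_norm_one_sub_le (a := y) (by linarith [htriangle a])
  rw [hy', ha', le_antisymm (a := ‖y‖) (b := ‖a‖) (by linarith [htriangle a])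
    (by linarith [htriangle y])]

variable {P : Lp 𝕜 ∞ μ →L[𝕜] Lp 𝕜 ∞ μ}

theorem IsLpProjection.ae_norm_add_norm_sub_le (hP : IsLpProjection ∞ P) {f g : Lp 𝕜 ∞ μ}
    (hf : ‖f‖ ≤ 1) (hg : ‖g‖ ≤ 1) : ∀ᵐ x ∂μ, ‖P f x‖ + ‖g x - P g x‖ ≤ 1 := by
  obtain ⟨hidem, -, hmax⟩ := hP
  have hPP (f : Lp 𝕜 ∞ μ) : P (P f) = P f := congrArg (· f) hidem
  have hnorm (c : 𝕜) : ‖P f + c • (g - P g)‖ ≤ max 1 ‖c‖ := by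
    rw [hmax rfl]
    simp only [map_add, map_smul, map_sub, hPP, sub_self, smul_zero, add_zero,
      add_sub_cancel_left, norm_smul]
    have hPf : ‖P f‖ ≤ 1 := ((le_max_left _ _).trans_eq (hmax rfl f).symm).trans hf
    have hPg : ‖g - P g‖ ≤ 1 := ((le_max_right _ _).trans_eq (hmax rfl g).symm).trans hg
    exact max_le_max hPf (mul_le_of_le_one_right (norm_nonneg c) hPg)
  have hseq : ∀ᵐ x ∂μ, ∀ n, ‖P f x + TopologicalSpace.denseSeq 𝕜 n * (g x - P g x)‖ ≤
      max 1 ‖TopologicalSpace.denseSeq 𝕜 n‖ := by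
    refine ae_all_iff.2 fun n ↦ ?_
    set c := TopologicalSpace.denseSeq 𝕜 n
    filter_upwards [ae_norm_le_norm (P f + c • (g - P g)), Lp.coeFn_add (P f) (c • (g - P g)),
      Lp.coeFn_smul c (g - P g), Lp.coeFn_sub g (P g)] with x hle hadd hsmul hsub
    rw [hadd, Pi.add_apply, hsmul, Pi.smul_apply, hsub, Pi.sub_apply, smul_eq_mul] at hle
    exact hle.trans (hnorm c)
  filter_upwards [hseq] with x hx
  have hall (c : 𝕜) : ‖P f x + c * (g x - P g x)‖ ≤ max 1 ‖c‖ :=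
    (TopologicalSpace.denseRange_denseSeq 𝕜).induction_on c
      (isClosed_le (by fun_prop) (by fun_prop)) hx
  obtain ⟨c, hc, hsum⟩ := exists_norm_add_mul_eq (P f x) (g x - P g x)
  rw [← hsum]
  exact (hall c).trans_eq (by rw [hc, max_self])

theorem IsLpProjection.coe_apply_eq_mul (hP : IsLpProjection ∞ P) {v : Lp 𝕜 ∞ μ}
    (hv : ∀ᵐ x ∂μ, ‖v x‖ = 1) : (P v : Ω →ₘ[μ] 𝕜) = P (chiTop μ 𝕜 Set.univ) * v := by
  have hone := norm_chiTop_le (μ := μ) (𝕜 := 𝕜) Set.univ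
  have hnorm_v : ‖v‖ ≤ 1 := norm_le_of_ae_norm_le zero_le_one (hv.mono fun _ h ↦ h.le)
  refine AEEqFun.ext ?_
  filter_upwards [hP.ae_norm_add_norm_sub_le hnorm_v hone, hP.ae_norm_add_norm_sub_le hone hnorm_v,
    hv, coeFn_chiTop (μ := μ) (𝕜 := 𝕜) .univ,
    AEEqFun.coeFn_mul (P (chiTop μ 𝕜 Set.univ) : Ω →ₘ[μ] 𝕜) v] with x hv_one hone_v hvx hchi hmul
  rw [hchi, Set.indicator_univ] at hv_one
  rw [hmul, Pi.mul_apply]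
  exact eq_mul_of_norm_add_norm_sub_le hvx hv_one hone_v

theorem IsLpProjection.isMultiplicationOp_top (hP : IsLpProjection ∞ P) :
    IsMultiplicationOp P := by
  refine isMultiplicationOp_iff.2 ⟨P (chiTop μ 𝕜 Set.univ),
    ContinuousLinearMap.ext_on dense_span_chiTop ?_⟩
  rintro _ ⟨A, hA, rfl⟩
  let v : Lp 𝕜 ∞ μ := (2 : 𝕜) • chiTop μ 𝕜 A - chiTop μ 𝕜 Set.univ
  have hv : ∀ᵐ x ∂μ, ‖v x‖ = 1 := by
    filter_upwards [Lp.coeFn_sub ((2 : 𝕜) • chiTop μ 𝕜 A) (chiTop μ 𝕜 Set.univ),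
      Lp.coeFn_smul (2 : 𝕜) (chiTop μ 𝕜 A), coeFn_chiTop (μ := μ) (𝕜 := 𝕜) hA,
      coeFn_chiTop (μ := μ) (𝕜 := 𝕜) .univ] with x hsub hsmul hchi hone
    rw [hsub, Pi.sub_apply, hsmul, Pi.smul_apply, hchi, hone, Set.indicator_univ, smul_eq_mul]
    by_cases hx : x ∈ A <;> norm_num [hx]
  have hPv : ((2 : 𝕜) • P (chiTop μ 𝕜 A) - P (chiTop μ 𝕜 Set.univ) : Lp 𝕜 ∞ μ) =
      P (chiTop μ 𝕜 Set.univ) * ((2 : 𝕜) • chi μ 𝕜 A - chi μ 𝕜 Set.univ) := by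
    rw [← map_smul, ← map_sub]
    exact hP.coe_apply_eq_mul hv
  rw [AddSubgroupClass.coe_sub, chi_univ, mul_sub, mul_one, sub_left_inj, mul_smul_comm] at hPv
  refine Subtype.ext ?_
  rw [coe_mulOp]
  exact smul_right_injective _ (two_ne_zero (α := 𝕜)) hPv

theorem IsLpProjection.isMultiplicationOp (hμ : IsLocalizable μ) (hp2 : p ≠ 2)
    {P : Lp 𝕜 p μ →L[𝕜] Lp 𝕜 p μ} (hP : IsLpProjection p P) : IsMultiplicationOp P := by
  rcases eq_or_ne p ∞ with rfl | hpt
  · exact hP.isMultiplicationOp_top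
  · exact hP.isMultiplicationOp_of_ne_top hμ hp2 hpt

theorem isLpProjection_chiOp {D : Set Ω} (hD : MeasurableSet D) :
    IsLpProjection p (chiOp p μ 𝕜 D) := by
  have hsplit (ξ : Lp 𝕜 p μ) : ∀ᵐ x ∂μ,
      (‖chiOp p μ 𝕜 D ξ x‖ = ‖ξ x‖ ∧ ‖(ξ - chiOp p μ 𝕜 D ξ) x‖ = 0) ∨
        (‖chiOp p μ 𝕜 D ξ x‖ = 0 ∧ ‖(ξ - chiOp p μ 𝕜 D ξ) x‖ = ‖ξ x‖) := by
    filter_upwards [coeFn_chi_mul hD (ξ : Ω →ₘ[μ] 𝕜), Lp.coeFn_sub ξ (chiOp p μ 𝕜 D ξ)]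
      with x hchi hsub
    rw [← coe_chiOp] at hchi
    rw [hsub, Pi.sub_apply, hchi]
    by_cases hx : x ∈ D <;> simp [hx]
  refine ⟨?_, fun hpt ξ ↦ ?_, ?_⟩
  · exact isIdempotentElem_chiOp hD
  · have hp0 : p ≠ 0 := (zero_lt_one.trans_le (Fact.out : 1 ≤ p)).ne'
    have hint (f : Lp 𝕜 p μ) : Integrable (fun x ↦ ‖f x‖ ^ p.toReal) μ :=
      (Lp.memLp f).integrable_norm_rpow hp0 hpt
    simp only [norm_rpow_eq_integral hpt]
    rw [← integral_add (hint _) (hint _)]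
    refine integral_congr_ae ?_
    filter_upwards [hsplit ξ] with x hx
    have hzero := Real.zero_rpow (ENNReal.toReal_pos hp0 hpt).ne'
    rcases hx with ⟨hin, hout⟩ | ⟨hin, hout⟩ <;> simp only [hin, hout, hzero, add_zero, zero_add]
  · rintro rfl ξ
    apply le_antisymm
    · refine norm_le_of_ae_norm_le (le_max_of_le_left (norm_nonneg _)) ?_
      filter_upwards [hsplit ξ, ae_norm_le_norm (chiOp ∞ μ 𝕜 D ξ),
        ae_norm_le_norm (ξ - chiOp ∞ μ 𝕜 D ξ)] with x hx hle_in hle_out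
      rcases hx with ⟨hin, -⟩ | ⟨-, hout⟩
      · exact hin ▸ le_max_of_le_left hle_in
      · exact hout ▸ le_max_of_le_right hle_out
    · refine max_le (norm_le_of_ae_norm_le (norm_nonneg _) ?_)
        (norm_le_of_ae_norm_le (norm_nonneg _) ?_) <;>
      filter_upwards [hsplit ξ, ae_norm_le_norm ξ] with x hx hle
      all_goals rcases hx with ⟨hin, hout⟩ | ⟨hin, hout⟩ <;>
        simp only [hin, hout, hle, norm_nonneg]

end LpProjection

/-! ### Inverse semigroups -/

section Semigroup

variable {M : Type*} [Semigroup M]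

namespace IsGenInverse

theorem symm {s t : M} (h : IsGenInverse t s) : IsGenInverse s t :=
  ⟨h.2, h.1⟩

theorem isIdempotentElem_mul {s t : M} (h : IsGenInverse t s) : IsIdempotentElem (t * s) := by
  rw [IsIdempotentElem, ← mul_assoc, ← h.1]

theorem eq_of_commute {s r t : M} (hs : IsGenInverse t s) (hr : IsGenInverse t r)
    (hleft : Commute (t * s) (t * r)) (hright : Commute (s * t) (r * t)) : s = r :=
  calc s = s * t * s := hs.2
    _ = s * (t * r * t) * s := by rw [← hr.1]
    _ = s * (t * r * (t * s)) := by simp only [mul_assoc]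
    _ = s * t * s * (t * r) := by rw [← hleft.eq]; simp only [mul_assoc]
    _ = s * t * (r * t * r) := by rw [← hs.2, ← hr.2, mul_assoc]
    _ = s * t * (r * t) * r := by simp only [mul_assoc]
    _ = r * (t * s * t) * r := by rw [hright.eq]; simp only [mul_assoc]
    _ = r := by rw [← hs.1, ← hr.2]

theorem mul_of_commute {s t s' t' : M} (h : IsGenInverse t s) (h' : IsGenInverse t' s')
    (hcomm : Commute (s * t) (t' * s')) : IsGenInverse (t * t') (s' * s) := by
  constructor
  · calc t * t' = t * s * t * (t' * s' * t') := by rw [← h.1, ← h'.1]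
      _ = t * (s * t * (t' * s')) * t' := by simp only [mul_assoc]
      _ = t * t' * (s' * s) * (t * t') := by rw [hcomm.eq]; simp only [mul_assoc]
  · calc s' * s = s' * t' * s' * (s * t * s) := by rw [← h.2, ← h'.2]
      _ = s' * (t' * s' * (s * t)) * s := by simp only [mul_assoc]
      _ = s' * s * (t * t') * (s' * s) := by rw [← hcomm.eq]; simp only [mul_assoc]

theorem eq_mul_of_isIdempotentElem {e f : M} (hef : IsGenInverse e f) (he : IsIdempotentElem e)
    (hcomm : Commute (e * f) (f * e)) : e = f * e := by
  have habsorb : e * f * (f * e) = e * f :=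
    calc e * f * (f * e) = e * e * f * (f * e) := by rw [he.eq]
      _ = e * (e * f * (f * e)) := by simp only [mul_assoc]
      _ = e * f * e * e * f := by rw [hcomm.eq]; simp only [mul_assoc]
      _ = e * f := by rw [← hef.1, he.eq]
  calc e = e * f * e := hef.1
    _ = f * e * (e * f) * e := by rw [← hcomm.eq, habsorb]
    _ = f * e * (e * f * e) := by simp only [mul_assoc]
    _ = f * e := by rw [← hef.1, mul_assoc, he.eq]

end IsGenInverse

theorem isInverseSubsemigroup_of_commute {A : Set M} (hmul : ∀ s ∈ A, ∀ t ∈ A, s * t ∈ A)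
    (hinv : ∀ t ∈ A, ∃ s ∈ A, IsGenInverse t s)
    (hcomm : ∀ e ∈ A, ∀ f ∈ A, IsIdempotentElem e → IsIdempotentElem f → Commute e f) :
    IsInverseSubsemigroup A := by
  refine ⟨hmul, fun t ht ↦ ?_⟩
  obtain ⟨s, hs, hts⟩ := hinv t ht
  refine ⟨s, ⟨hs, hts⟩, fun r ⟨hr, htr⟩ ↦ htr.eq_of_commute hts ?_ ?_⟩
  · exact hcomm _ (hmul t ht r hr) _ (hmul t ht s hs) htr.isIdempotentElem_mul
      hts.isIdempotentElem_mul
  · exact hcomm _ (hmul r hr t ht) _ (hmul s hs t ht) htr.symm.isIdempotentElem_mul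
      hts.symm.isIdempotentElem_mul

end Semigroup

/-! ### Conjugation by a partial isometry -/

section Conjugation

variable {𝕜 E : Type*} [RCLike 𝕜] [NormedAddCommGroup E] [NormedSpace 𝕜 E] {p : ℝ≥0∞}
  {T S P : E →L[𝕜] E}

theorem norm_apply_eq_of_leftInverse (hT : ‖T‖ ≤ 1) (hS : ‖S‖ ≤ 1) {ξ : E} (h : S (T ξ) = ξ) :
    ‖T ξ‖ = ‖ξ‖ := by
  refine le_antisymm ?_ ?_
  · simpa using T.le_of_opNorm_le hT ξ
  · simpa [h] using S.le_of_opNorm_le hS (T ξ)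

theorem IsLpProjection.conj (hT : ‖T‖ ≤ 1) (hS : ‖S‖ ≤ 1) (hTS : IsGenInverse T S)
    (hQ : IsLpProjection p (T * S)) (hP : IsLpProjection p P) (hcomm : Commute (S * T) P) :
    IsLpProjection p (T * P * S) := by
  have hTST (ξ : E) : T (S (T ξ)) = T ξ := (congrArg (· ξ) hTS.1).symm
  have hSTS (ξ : E) : S (T (S ξ)) = S ξ := (congrArg (· ξ) hTS.2).symm
  have hSTP (ξ : E) : S (T (P ξ)) = P (S (T ξ)) := congrArg (· ξ) hcomm.eq
  have hPP (ξ : E) : P (P ξ) = P ξ := congrArg (· ξ) hP.1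
  have hnorm (ξ : E) : ‖T (S ξ)‖ = ‖S ξ‖ := norm_apply_eq_of_leftInverse hT hS (hSTS ξ)
  have hnorm_P (ξ : E) : ‖T (P (S ξ))‖ = ‖P (S ξ)‖ :=
    norm_apply_eq_of_leftInverse hT hS (by rw [hSTP, hSTS])
  have hnorm_sub (ξ : E) : ‖T (S ξ) - T (P (S ξ))‖ = ‖S ξ - P (S ξ)‖ := by
    rw [← map_sub]
    exact norm_apply_eq_of_leftInverse hT hS (by rw [map_sub, map_sub, hSTP, hSTS])
  have hQ_sub (ξ : E) : T (S (ξ - T (P (S ξ)))) = T (S ξ) - T (P (S ξ)) := by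
    rw [map_sub, map_sub, hTST]
  refine ⟨ContinuousLinearMap.ext fun ξ ↦ ?_, fun hpt ξ ↦ ?_, fun hpt ξ ↦ ?_⟩
  · simp only [mul_apply_eq_comp, hSTP, hSTS, hPP]
  · have hξ := hQ.2.1 hpt ξ
    have hη := hQ.2.1 hpt (ξ - T (P (S ξ)))
    have hPξ := hP.2.1 hpt (S ξ)
    simp only [mul_apply_eq_comp, hQ_sub, sub_sub_sub_cancel_right] at hξ hη ⊢
    rw [hξ, hη, hnorm, hnorm_P, hnorm_sub, hPξ, add_assoc]
  · have hξ := hQ.2.2 hpt ξ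
    have hη := hQ.2.2 hpt (ξ - T (P (S ξ)))
    have hPξ := hP.2.2 hpt (S ξ)
    simp only [mul_apply_eq_comp, hQ_sub, sub_sub_sub_cancel_right] at hξ hη ⊢
    rw [hξ, hη, hnorm, hnorm_P, hnorm_sub, hPξ, max_assoc]

end Conjugation

/-! ### The partial set automorphism of a partial isometry -/

section Pair

variable {Ω 𝕜 : Type*} [MeasurableSpace Ω] {μ : Measure Ω} [RCLike 𝕜] {p : ℝ≥0∞} [Fact (1 ≤ p)]

theorem IsLocalizable.chiOp_eq_chiOp_iff (hμ : IsLocalizable μ) {A B : Set Ω}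
    (hA : MeasurableSet A) (hB : MeasurableSet B) :
    chiOp p μ 𝕜 A = chiOp p μ 𝕜 B ↔ A =ᵐ[μ] B := by
  refine ⟨fun h ↦ ?_, chiOp_congr hA hB⟩
  have hdiff {A B : Set Ω} (hA : MeasurableSet A) (hB : MeasurableSet B)
      (h : chiOp p μ 𝕜 A = chiOp p μ 𝕜 B) : A ≤ᵐ[μ] B :=
    ae_le_set.2 <| (hμ.isSemifinite.chiOp_mul_chiOp_eq_iff (p := p) (𝕜 := 𝕜) hA hB).1 <| by
      rw [← h, (isIdempotentElem_chiOp hA).eq]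
  exact (hdiff hA hB h).antisymm (hdiff hB hA h.symm)

/-- `T` implements `Φ`: it intertwines the multiplications by the indicator functions of `C` and
`Φ(C)`, for all measurable `C ⊆ D_{Φ*}`. -/
def Implements (T : Lp 𝕜 p μ →L[𝕜] Lp 𝕜 p μ) (Φ : PartialSetAut μ) : Prop :=
  ∀ C, MeasurableSet C → C ⊆ Φ.dom → T * chiOp p μ 𝕜 C = chiOp p μ 𝕜 (Φ.toFun C) * T

namespace IsChiPair

variable {T S : Lp 𝕜 p μ →L[𝕜] Lp 𝕜 p μ} {D D' : Set Ω}

theorem symm (h : IsChiPair T S D D') : IsChiPair S T D' D where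
  measurableSet_left := h.measurableSet_right
  measurableSet_right := h.measurableSet_left
  norm_left_le := h.norm_right_le
  norm_right_le := h.norm_left_le
  mul_left := h.mul_right
  mul_right := h.mul_left
  isGenInverse := h.isGenInverse.symm

theorem chiOp_mul (h : IsChiPair T S D D') : chiOp p μ 𝕜 D * T = T := by
  rw [← h.mul_left, ← h.isGenInverse.1]

theorem mul_chiOp (h : IsChiPair T S D D') : T * chiOp p μ 𝕜 D' = T := by
  rw [← h.mul_right, ← mul_assoc, ← h.isGenInverse.1]

theorem mul_chiOp_of_mul_chiOp (h : IsChiPair T S D D') {B C : Set Ω} (hB : MeasurableSet B)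
    (hBD : B ⊆ D) (hC : MeasurableSet C) (hCD : C ⊆ D')
    (hT : T * chiOp p μ 𝕜 C = chiOp p μ 𝕜 B * T) :
    S * chiOp p μ 𝕜 B = chiOp p μ 𝕜 C * S :=
  calc S * chiOp p μ 𝕜 B
      = S * (chiOp p μ 𝕜 B * T) * S := by
        rw [mul_assoc, mul_assoc, h.mul_left, chiOp_mul_chiOp hB h.measurableSet_left,
          Set.inter_eq_left.2 hBD]
    _ = S * T * chiOp p μ 𝕜 C * S := by rw [← hT, mul_assoc S T]
    _ = chiOp p μ 𝕜 C * S := by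
        rw [h.mul_right, chiOp_mul_chiOp h.measurableSet_right hC, Set.inter_eq_right.2 hCD]

theorem mul_chiOp_mul (h : IsChiPair T S D D') {B C : Set Ω} (hB : MeasurableSet B)
    (hBD : B ⊆ D) (hT : T * chiOp p μ 𝕜 C = chiOp p μ 𝕜 B * T) :
    T * chiOp p μ 𝕜 C * S = chiOp p μ 𝕜 B := by
  rw [hT, mul_assoc, h.mul_left, chiOp_mul_chiOp hB h.measurableSet_left, Set.inter_eq_left.2 hBD]

theorem measure_sdiff_eq_zero (h : IsChiPair T S D D') (hμ : IsLocalizable μ)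
    {B B' C C' : Set Ω} (hB : MeasurableSet B) (hBD : B ⊆ D) (hB' : MeasurableSet B')
    (hC : MeasurableSet C) (hC' : MeasurableSet C')
    (hT : T * chiOp p μ 𝕜 C = chiOp p μ 𝕜 B * T) (hT' : T * chiOp p μ 𝕜 C' = chiOp p μ 𝕜 B' * T)
    (hCC' : μ (C \ C') = 0) : μ (B \ B') = 0 := by
  rw [← hμ.isSemifinite.chiOp_mul_chiOp_eq_iff (p := p) (𝕜 := 𝕜) hC hC'] at hCC'
  rw [← hμ.isSemifinite.chiOp_mul_chiOp_eq_iff (p := p) (𝕜 := 𝕜) hB hB',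
    ← h.mul_chiOp_mul hB hBD hT, ← mul_assoc, ← mul_assoc, ← hT', mul_assoc T, hCC']

variable (hμ : IsLocalizable μ) (hp2 : p ≠ 2)
include hμ hp2

theorem exists_conj_chiOp_eq (h : IsChiPair T S D D') {A : Set Ω} (hA : MeasurableSet A) :
    ∃ B, MeasurableSet B ∧ B ⊆ D ∧ T * chiOp p μ 𝕜 A * S = chiOp p μ 𝕜 B := by
  have hprojection : IsLpProjection p (T * chiOp p μ 𝕜 A * S) := by
    refine IsLpProjection.conj h.norm_left_le h.norm_right_le h.isGenInverse ?_
      (isLpProjection_chiOp hA) ?_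
    · rw [h.mul_left]
      exact isLpProjection_chiOp h.measurableSet_left
    · rw [h.mul_right]
      exact (isMultiplicationOp_chiOp D').commute (isMultiplicationOp_chiOp A)
  obtain ⟨B, hB, hTS⟩ :=
    (hprojection.isMultiplicationOp hμ hp2).exists_eq_chiOp hprojection.1
  refine ⟨D ∩ B, h.measurableSet_left.inter hB, Set.inter_subset_left, ?_⟩
  rw [← chiOp_mul_chiOp h.measurableSet_left hB, ← hTS, ← mul_assoc, ← mul_assoc, h.chiOp_mul]

theorem exists_mul_chiOp_eq (h : IsChiPair T S D D') {C : Set Ω} (hC : MeasurableSet C)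
    (hCD : C ⊆ D') :
    ∃ B, MeasurableSet B ∧ B ⊆ D ∧ T * chiOp p μ 𝕜 C = chiOp p μ 𝕜 B * T := by
  obtain ⟨B, hB, hBD, hTS⟩ := h.exists_conj_chiOp_eq hμ hp2 hC
  refine ⟨B, hB, hBD, ?_⟩
  rw [← hTS, mul_assoc _ S, h.mul_right, mul_assoc T,
    chiOp_mul_chiOp hC h.measurableSet_right, Set.inter_eq_left.2 hCD]

theorem exists_partialSetAut (h : IsChiPair T S D D') :
    ∃ Φ : PartialSetAut μ, Φ.dom = D' ∧ Φ.cod = D ∧ Implements T Φ := by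
  choose! F hF hF_subset hTF using fun C ↦ h.exists_mul_chiOp_eq (C := C) hμ hp2
  choose! G hG hG_subset hSG using fun C ↦ h.symm.exists_mul_chiOp_eq (C := C) hμ hp2
  have hSF (C : Set Ω) (hC : MeasurableSet C) (hCD : C ⊆ D') :
      S * chiOp p μ 𝕜 (F C) = chiOp p μ 𝕜 C * S :=
    h.mul_chiOp_of_mul_chiOp (hF C hC hCD) (hF_subset C hC hCD) hC hCD (hTF C hC hCD)
  refine ⟨⟨D', D, h.measurableSet_right, h.measurableSet_left, F, G,
    fun C hC hCD ↦ ⟨hF C hC hCD, hF_subset C hC hCD⟩,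
    fun C hC hCD ↦ ⟨hG C hC hCD, hG_subset C hC hCD⟩,
    fun C C' hC hCD hC' hCD' ↦ ⟨?_, ?_⟩, fun C hC hCD ↦ ?_⟩, rfl, rfl, hTF⟩
  · exact h.measure_sdiff_eq_zero hμ (hF C hC hCD) (hF_subset C hC hCD) (hF C' hC' hCD') hC hC'
      (hTF C hC hCD) (hTF C' hC' hCD')
  · exact h.symm.measure_sdiff_eq_zero hμ hC hCD hC' (hF C hC hCD) (hF C' hC' hCD')
      (hSF C hC hCD) (hSF C' hC' hCD')
  · have hGC := hG C hC hCD
    have hGC_subset := hG_subset C hC hCD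
    have hTG : T * chiOp p μ 𝕜 (G C) = chiOp p μ 𝕜 C * T :=
      h.symm.mul_chiOp_of_mul_chiOp hGC hGC_subset hC hCD (hSG C hC hCD)
    rw [← hμ.chiOp_eq_chiOp_iff (p := p) (𝕜 := 𝕜) (hF _ hGC hGC_subset) hC,
      ← h.mul_chiOp_mul (hF _ hGC hGC_subset) (hF_subset _ hGC hGC_subset)
        (hTF _ hGC hGC_subset), h.mul_chiOp_mul hC hCD hTG]

end IsChiPair

end Pair

/-! ### The spatial form of a partial isometry -/

section SpatialForm

variable {Ω 𝕜 : Type*} [MeasurableSpace Ω] {μ : Measure Ω} [RCLike 𝕜] {p : ℝ≥0∞}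
  {Φ : PartialSetAut μ}

theorem IsLocalizable.exists_isSpatialWeight (hμ : IsLocalizable μ) (p : ℝ≥0∞)
    (Φ : PartialSetAut μ) : ∃ a : Ω →ₘ[μ] 𝕜, IsSpatialWeight p Φ a := by
  obtain ⟨h, hh⟩ := hμ.exists_isRNDeriv Φ
  have hmeas : Measurable fun x ↦ (((h x : ℝ) ^ (1 / p.toReal) : ℝ) : 𝕜) :=
    RCLike.measurable_ofReal.comp (hh.measurable.coe_nnreal_real.pow_const _)
  refine ⟨AEEqFun.mk _ hmeas.aestronglyMeasurable, h, hh, ?_⟩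
  filter_upwards [AEEqFun.coeFn_mk _ hmeas.aestronglyMeasurable] with x hx _
  rw [hx, RCLike.norm_ofReal, abs_of_nonneg (by positivity)]

variable [Fact (1 ≤ p)] {T S U U' : Lp 𝕜 p μ →L[𝕜] Lp 𝕜 p μ}

theorem implements_of_coe_eq_mul_compOp {a : Ω →ₘ[μ] 𝕜}
    (hU : ∀ f : Lp 𝕜 p μ, (U f : Ω →ₘ[μ] 𝕜) = a * compOp 𝕜 Φ f) : Implements U Φ := by
  refine fun C hC hCD ↦ ContinuousLinearMap.ext fun f ↦ Subtype.ext ?_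
  rw [mul_apply_eq_comp, mul_apply_eq_comp, hU, coe_chiOp, coe_chiOp, hU, compOp_mul,
    compOp_chi Φ hC, Set.inter_eq_left.2 hCD, mul_left_comm]

theorem IsChiPair.commute_mul_chiOp (hT : IsChiPair T S Φ.cod Φ.dom) (hTΦ : Implements T Φ)
    (hU : IsChiPair U U' Φ.cod Φ.dom) (hUΦ : Implements U Φ) {A : Set Ω} (hA : MeasurableSet A) :
    Commute (T * U') (chiOp p μ 𝕜 A) := by
  have hcod := Φ.measurableSet_cod
  have hAD : A ∩ Φ.cod ⊆ Φ.cod := Set.inter_subset_right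
  obtain ⟨hC, hCD⟩ := Φ.invFun_mem _ (hA.inter hcod) hAD
  obtain ⟨hB, hBD⟩ := Φ.toFun_mem _ hC hCD
  set C := Φ.invFun (A ∩ Φ.cod)
  have hΦC : chiOp p μ 𝕜 (Φ.toFun C) = chiOp p μ 𝕜 (A ∩ Φ.cod) :=
    chiOp_congr hB (hA.inter hcod) (Φ.toFun_invFun _ (hA.inter hcod) hAD)
  have hTA : chiOp p μ 𝕜 A * T = T * chiOp p μ 𝕜 C := by
    rw [hTΦ C hC hCD, hΦC, ← chiOp_mul_chiOp hA hcod, mul_assoc, hT.chiOp_mul]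
  have hUA : U' * chiOp p μ 𝕜 A = chiOp p μ 𝕜 C * U' := by
    rw [← hU.mul_chiOp_of_mul_chiOp hB hBD hC hCD (hUΦ C hC hCD), hΦC, Set.inter_comm,
      ← chiOp_mul_chiOp hcod hA, ← mul_assoc, hU.symm.mul_chiOp]
  rw [Commute, SemiconjBy, mul_assoc, hUA, ← mul_assoc, ← mul_assoc, hTA]

theorem IsSemifinite.ae_norm_eq_one_of_mulOp_mul_mulOp (hμ : IsSemifinite μ) {D : Set Ω}
    (hD : MeasurableSet D) {w w' : Lp 𝕜 ∞ μ} (hw : ‖mulOp p w‖ ≤ 1) (hw' : ‖mulOp p w'‖ ≤ 1)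
    (h : mulOp p w * mulOp p w' = chiOp p μ 𝕜 D) : ∀ᵐ x ∂μ, x ∈ D → ‖w x‖ = 1 := by
  have hsub (f : Lp 𝕜 p μ) : ((0 : Lp 𝕜 p μ →L[𝕜] Lp 𝕜 p μ) f : Ω →ₘ[μ] 𝕜) =
      ((w : Ω →ₘ[μ] 𝕜) * w' - chi μ 𝕜 D) * f := by
    have hf := congrArg Subtype.val (DFunLike.congr_fun h f)
    rw [mul_apply_eq_comp, coe_mulOp, coe_mulOp, coe_chiOp] at hf
    rw [sub_mul, mul_assoc, hf, sub_self]
    rfl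
  filter_upwards [hμ.ae_norm_le_opNorm hsub, hμ.ae_norm_le_opNorm (coe_mulOp (p := p) w),
    hμ.ae_norm_le_opNorm (coe_mulOp (p := p) w'), coeFn_chi (μ := μ) (𝕜 := 𝕜) hD,
    AEEqFun.coeFn_sub ((w : Ω →ₘ[μ] 𝕜) * (w' : Ω →ₘ[μ] 𝕜)) (chi μ 𝕜 D),
    AEEqFun.coeFn_mul (w : Ω →ₘ[μ] 𝕜) (w' : Ω →ₘ[μ] 𝕜)] with x hzero hwx hwx' hchi hsubx hmul hx
  rw [hsubx, Pi.sub_apply, hmul, Pi.mul_apply, hchi, Set.indicator_of_mem hx, norm_zero,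
    norm_le_zero_iff, sub_eq_zero] at hzero
  refine (hwx.trans hw).antisymm ?_
  calc 1 = ‖w x‖ * ‖w' x‖ := by rw [← norm_mul, hzero, norm_one]
    _ ≤ ‖w x‖ := mul_le_of_le_one_right (norm_nonneg _) (hwx'.trans hw')

theorem IsChiPair.mem_SPIso_of_implements (hT : IsChiPair T S Φ.cod Φ.dom)
    (hTΦ : Implements T Φ) (hμ : IsLocalizable μ) : T ∈ SPIso 𝕜 p μ := by
  obtain ⟨a, h, hh, hah⟩ := hμ.exists_isSpatialWeight (𝕜 := 𝕜) p Φ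
  obtain ⟨U, U', hU, hUa⟩ := IsSpatialWeight.exists_isChiPair ⟨h, hh, hah⟩
  have hUΦ : Implements U Φ := implements_of_coe_eq_mul_compOp hUa
  obtain ⟨w, hw⟩ := isMultiplicationOp_iff.1 <|
    isMultiplicationOp_of_commute_chiOp hμ fun A hA ↦ hT.commute_mul_chiOp hTΦ hU hUΦ hA
  obtain ⟨w', hw'⟩ := isMultiplicationOp_iff.1 <|
    isMultiplicationOp_of_commute_chiOp hμ fun A hA ↦ hU.commute_mul_chiOp hUΦ hT hTΦ hA
  have hww' : mulOp p w * mulOp p w' = chiOp p μ 𝕜 Φ.cod := by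
    rw [← hw, ← hw', mul_assoc, ← mul_assoc U', hU.mul_right, ← mul_assoc, hT.mul_chiOp,
      hT.mul_left]
  have hnorm : ∀ᵐ x ∂μ, x ∈ Φ.cod → ‖w x‖ = 1 := by
    refine hμ.isSemifinite.ae_norm_eq_one_of_mulOp_mul_mulOp Φ.measurableSet_cod ?_ ?_ hww'
    · rw [← hw]
      exact (norm_mul_le _ _).trans
        (mul_le_one₀ hT.norm_left_le (norm_nonneg _) hU.norm_right_le)
    · rw [← hw']
      exact (norm_mul_le _ _).trans
        (mul_le_one₀ hU.norm_left_le (norm_nonneg _) hT.norm_right_le)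
  refine mem_SPIso_iff.2 ⟨Φ, (w : Ω →ₘ[μ] 𝕜) * a, ⟨h, hh, ?_⟩, fun f ↦ ?_⟩
  · filter_upwards [hnorm, hah, AEEqFun.coeFn_mul (w : Ω →ₘ[μ] 𝕜) a] with x hwx hax hmul hx
    rw [hmul, Pi.mul_apply, norm_mul, hwx hx, one_mul, hax hx]
  · rw [mul_assoc, ← hUa, ← coe_mulOp, ← hw, ← mul_apply_eq_comp, mul_assoc, hU.mul_right,
      hT.mul_chiOp]

theorem SPIso_eq_setOf_isChiPair (hμ : IsLocalizable μ) (hp2 : p ≠ 2) :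
    SPIso 𝕜 p μ = {T | ∃ S D D', IsChiPair T S D D'} := by
  refine Set.ext fun T ↦ ⟨exists_isChiPair_of_mem_SPIso, ?_⟩
  rintro ⟨S, D, D', hT⟩
  obtain ⟨Φ, rfl, rfl, hTΦ⟩ := hT.exists_partialSetAut hμ hp2
  exact hT.mem_SPIso_of_implements hTΦ hμ

end SpatialForm

/-! ### Hermitian idempotents -/

section Hermitian

theorem exp_smul_of_isIdempotentElem {B : Type*} [NormedRing B] [NormedAlgebra ℂ B]
    [CompleteSpace B] {e : B} (he : IsIdempotentElem e) (c : ℂ) :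
    NormedSpace.exp (c • e) = 1 + (Complex.exp c - 1) • e := by
  have hterm (n : ℕ) : (n.factorial : ℂ)⁻¹ • (c • e) ^ n =
      ((n.factorial : ℂ)⁻¹ • c ^ n) • e + if n = 0 then 1 - e else 0 := by
    cases n with
    | zero => simp
    | succ n => simp [smul_pow, he.pow_succ_eq, smul_smul]
  have hsum : HasSum (fun n : ℕ ↦ (n.factorial : ℂ)⁻¹ • (c • e) ^ n)
      (NormedSpace.exp c • e + (1 - e)) := by
    simp only [hterm]
    exact ((NormedSpace.exp_series_hasSum_exp' (𝕂 := ℂ) c).smul_const e).add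
      (hasSum_ite_eq 0 (1 - e))
  rw [(NormedSpace.exp_series_hasSum_exp' (𝕂 := ℂ) (c • e)).unique hsum, Complex.exp_eq_exp_ℂ,
    sub_smul, one_smul]
  abel

theorem one_add_smul_mul_one_add_smul {R A : Type*} [CommRing R] [Ring A] [Algebra R A] {e : A}
    (he : IsIdempotentElem e) (c d : R) :
    (1 + (c - 1) • e) * (1 + (d - 1) • e) = 1 + (c * d - 1) • e := by
  simp only [add_mul, mul_add, one_mul, mul_one, smul_mul_smul_comm, he.eq]
  module

theorem commute_of_commute_commutator {R : Type*} [Ring R] {e q : R} (hq : IsIdempotentElem q)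
    (h : Commute (e * q - q * e) q) : Commute e q := by
  set d := e * q - q * e with hd_def
  have hd : d = q * d + q * d := by
    nth_rewrite 2 [← h.eq]
    rw [hd_def, mul_sub, sub_mul, mul_assoc e, hq.eq, ← mul_assoc q q, hq.eq, mul_assoc q e]
    abel
  have hqd : q * d = 0 := by
    have hqd' := congrArg (q * ·) hd
    simp only [mul_add, ← mul_assoc, hq.eq] at hqd'
    exact left_eq_add.1 hqd'
  rw [hqd, add_zero] at hd
  exact sub_eq_zero.1 hd

theorem commute_of_commute_conj {A : Type*} [Ring A] [Algebra ℂ A] {e q : A}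
    (hq : IsIdempotentElem q)
    (hneg : Commute ((1 + (-1 - 1 : ℂ) • e) * q * (1 + (-1 - 1 : ℂ) • e)) q)
    (hI : Commute ((1 + (Complex.I - 1) • e) * q * (1 + (-Complex.I - 1) • e)) q) :
    Commute e q := by
  -- The combination of the two conjugates in which the terms `e * q * e` cancel.
  have hcommutator : e * q - q * e = (2 * Complex.I)⁻¹ •
      ((2 : ℂ) • ((1 + (Complex.I - 1) • e) * q * (1 + (-Complex.I - 1) • e)) -
        (1 + (-1 - 1 : ℂ) • e) * q * (1 + (-1 - 1 : ℂ) • e) - q) := by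
    simp only [add_mul, mul_add, one_mul, mul_one, smul_mul_assoc, mul_smul_comm]
    match_scalars <;> field_simp <;> ring_nf
    simp only [Complex.I_sq]
    ring
  refine commute_of_commute_commutator hq ?_
  rw [hcommutator]
  exact (((hI.smul_left 2).sub_left hneg).sub_left (.refl q)).smul_left _

variable {Ω : Type*} [MeasurableSpace Ω] {μ : Measure Ω} {p : ℝ≥0∞} [Fact (1 ≤ p)]

theorem isHermitianElem_chiOp (hμ : IsLocalizable μ) (hμ0 : μ ≠ 0) {D : Set Ω}
    (hD : MeasurableSet D) : IsHermitianElem (chiOp p μ ℂ D) := by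
  have hnontrivial : Nontrivial (Lp ℂ p μ) := by
    by_contra hn
    rw [not_nontrivial_iff_subsingleton] at hn
    refine hμ0 (Measure.measure_univ_eq_zero.1 ?_)
    refine hμ.isSemifinite.measure_eq_zero_of_forall_chi_mul (𝕜 := ℂ) (p := p) .univ fun f ↦ ?_
    rw [Subsingleton.elim f 0]
    exact mul_zero _
  intro t
  refine ContinuousLinearMap.homothety_norm _ fun f ↦ ?_
  rw [exp_smul_of_isIdempotentElem (isIdempotentElem_chiOp hD), one_mul]
  set c := Complex.exp (Complex.I * t)
  have hc : ‖c‖ = 1 := by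
    simpa only [c, mul_comm] using Complex.norm_exp_ofReal_mul_I t
  have hnorm : ∀ᵐ x ∂μ, ‖(f + (c - 1) • chiOp p μ ℂ D f : Lp ℂ p μ) x‖ = ‖f x‖ := by
    filter_upwards [Lp.coeFn_add f ((c - 1) • chiOp p μ ℂ D f),
      Lp.coeFn_smul (c - 1) (chiOp p μ ℂ D f), coeFn_chi_mul hD (f : Ω →ₘ[μ] ℂ)]
      with x hadd hsmul hchi
    rw [hadd, Pi.add_apply, hsmul, Pi.smul_apply, coe_chiOp, hchi, smul_eq_mul]
    by_cases hx : x ∈ D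
    · rw [Set.indicator_of_mem hx, sub_mul, one_mul, add_sub_cancel, norm_mul, hc, one_mul]
    · rw [Set.indicator_of_notMem hx, mul_zero, add_zero]
  exact le_antisymm (Lp.norm_le_norm_of_ae_le (hnorm.mono fun x hx ↦ hx.le))
    (Lp.norm_le_norm_of_ae_le (hnorm.mono fun x hx ↦ hx.ge))

variable (hμ : IsLocalizable μ) (hp2 : p ≠ 2)
include hμ hp2

theorem isMultiplicationOp_conj_chiOp {𝕜 : Type*} [RCLike 𝕜] {U V : Lp 𝕜 p μ →L[𝕜] Lp 𝕜 p μ}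
    (hU : ‖U‖ ≤ 1) (hV : ‖V‖ ≤ 1) (hUV : U * V = 1) (hVU : V * U = 1) {A : Set Ω}
    (hA : MeasurableSet A) : IsMultiplicationOp (U * chiOp p μ 𝕜 A * V) := by
  have hone : IsLpProjection p (1 : Lp 𝕜 p μ →L[𝕜] Lp 𝕜 p μ) :=
    chiOp_univ (p := p) (μ := μ) (𝕜 := 𝕜) ▸ isLpProjection_chiOp .univ
  refine (IsLpProjection.conj hU hV ?_ ?_ (isLpProjection_chiOp hA) ?_).isMultiplicationOp hμ hp2
  · exact ⟨by rw [hUV, one_mul], by rw [hVU, one_mul]⟩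
  · rwa [hUV]
  · rw [hVU]
    exact .one_left _

theorem IsHermitianElem.commute_conj_chiOp {e : Lp ℂ p μ →L[ℂ] Lp ℂ p μ}
    (hherm : IsHermitianElem e) (he : IsIdempotentElem e) {c d : ℂ} {t : ℝ}
    (hc : Complex.exp (Complex.I * t) = c) (hd : Complex.exp (Complex.I * (-t : ℝ)) = d)
    {A : Set Ω} (hA : MeasurableSet A) :
    Commute ((1 + (c - 1) • e) * chiOp p μ ℂ A * (1 + (d - 1) • e)) (chiOp p μ ℂ A) := by
  have hnorm_c : ‖1 + (c - 1) • e‖ ≤ 1 := by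
    rw [← hc, ← exp_smul_of_isIdempotentElem he, hherm t]
  have hnorm_d : ‖1 + (d - 1) • e‖ ≤ 1 := by
    rw [← hd, ← exp_smul_of_isIdempotentElem he, hherm (-t)]
  have hcd : c * d = 1 := by
    rw [← hc, ← hd, ← Complex.exp_add, Complex.ofReal_neg, mul_neg, add_neg_cancel,
      Complex.exp_zero]
  refine (isMultiplicationOp_conj_chiOp hμ hp2 hnorm_c hnorm_d ?_ ?_ hA).commute
    (isMultiplicationOp_chiOp A)
  · rw [one_add_smul_mul_one_add_smul he, hcd, sub_self, zero_smul, add_zero]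
  · rw [one_add_smul_mul_one_add_smul he, mul_comm, hcd, sub_self, zero_smul, add_zero]

theorem IsHermitianElem.isMultiplicationOp {e : Lp ℂ p μ →L[ℂ] Lp ℂ p μ}
    (hherm : IsHermitianElem e) (he : IsIdempotentElem e) : IsMultiplicationOp e := by
  have hexp_pi : Complex.exp (Complex.I * Real.pi) = -1 := by rw [mul_comm, Complex.exp_pi_mul_I]
  have hexp_neg_pi : Complex.exp (Complex.I * (-Real.pi : ℝ)) = -1 := by
    rw [Complex.ofReal_neg, mul_neg, Complex.exp_neg, hexp_pi, inv_neg_one]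
  have hexp_pi_div_two : Complex.exp (Complex.I * (Real.pi / 2 : ℝ)) = Complex.I := by
    rw [mul_comm, Complex.ofReal_div, Complex.ofReal_ofNat, Complex.exp_pi_div_two_mul_I]
  have hexp_neg_pi_div_two : Complex.exp (Complex.I * (-(Real.pi / 2) : ℝ)) = -Complex.I := by
    rw [Complex.ofReal_neg, mul_neg, Complex.exp_neg, hexp_pi_div_two, Complex.inv_I]
  exact isMultiplicationOp_of_commute_chiOp hμ fun A hA ↦
    commute_of_commute_conj (isIdempotentElem_chiOp hA)
      (hherm.commute_conj_chiOp hμ hp2 he hexp_pi hexp_neg_pi hA)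
      (hherm.commute_conj_chiOp hμ hp2 he hexp_pi_div_two hexp_neg_pi_div_two hA)

end Hermitian

/-! ### Descriptions of the partial isometries by indicator functions -/

section PartialIsometries

variable {Ω 𝕜 : Type*} [MeasurableSpace Ω] {μ : Measure Ω} [RCLike 𝕜] {p : ℝ≥0∞} [Fact (1 ≤ p)]
  {T S T' S' : Lp 𝕜 p μ →L[𝕜] Lp 𝕜 p μ}

theorem exists_isChiPair_iff : (∃ S D D', IsChiPair T S D D') ↔
    ‖T‖ ≤ 1 ∧ ∃ S : Lp 𝕜 p μ →L[𝕜] Lp 𝕜 p μ, ‖S‖ ≤ 1 ∧ IsGenInverse T S ∧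
      IsMultiplicationOp (T * S) ∧ IsMultiplicationOp (S * T) := by
  constructor
  · rintro ⟨S, D, D', h⟩
    exact ⟨h.norm_left_le, S, h.norm_right_le, h.isGenInverse,
      h.mul_left ▸ isMultiplicationOp_chiOp D, h.mul_right ▸ isMultiplicationOp_chiOp D'⟩
  · rintro ⟨hT, S, hS, hTS, hleft, hright⟩
    obtain ⟨D, hD, hTSD⟩ := hleft.exists_eq_chiOp hTS.isIdempotentElem_mul
    obtain ⟨D', hD', hSTD'⟩ := hright.exists_eq_chiOp hTS.symm.isIdempotentElem_mul
    exact ⟨S, D, D', hD, hD', hT, hS, hTSD, hSTD', hTS⟩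

theorem IsChiPair.isMultiplicationOp_of_isIdempotentElem {D D' : Set Ω}
    (h : IsChiPair T S D D') (hT : IsIdempotentElem T) : IsMultiplicationOp T := by
  rw [h.isGenInverse.eq_mul_of_isIdempotentElem hT, h.mul_right]
  · exact isMultiplicationOp_chiOp D'
  · rw [h.mul_left, h.mul_right]
    exact (isMultiplicationOp_chiOp D).commute (isMultiplicationOp_chiOp D')

variable (hμ : IsLocalizable μ) (hp2 : p ≠ 2)
include hμ hp2

theorem IsChiPair.mul {D E D' E' : Set Ω} (h : IsChiPair T S D E) (h' : IsChiPair T' S' D' E') :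
    ∃ F G, IsChiPair (T * T') (S' * S) F G := by
  obtain ⟨F, hF, -, hTF⟩ := h.exists_conj_chiOp_eq hμ hp2 h'.measurableSet_left
  obtain ⟨G, hG, -, hTG⟩ := h'.symm.exists_conj_chiOp_eq hμ hp2 h.measurableSet_right
  refine ⟨F, G, hF, hG, ?_, ?_, ?_, ?_, h.isGenInverse.mul_of_commute h'.isGenInverse ?_⟩
  · exact (norm_mul_le _ _).trans (mul_le_one₀ h.norm_left_le (norm_nonneg _) h'.norm_left_le)
  · exact (norm_mul_le _ _).trans (mul_le_one₀ h'.norm_right_le (norm_nonneg _) h.norm_right_le)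
  · rw [← hTF, ← h'.mul_left]
    simp only [mul_assoc]
  · rw [← hTG, ← h.mul_right]
    simp only [mul_assoc]
  · rw [h.mul_right, h'.mul_left]
    exact (isMultiplicationOp_chiOp E).commute (isMultiplicationOp_chiOp D')

theorem isInverseSubsemigroup_setOf_isChiPair :
    IsInverseSubsemigroup {T : Lp 𝕜 p μ →L[𝕜] Lp 𝕜 p μ | ∃ S D D', IsChiPair T S D D'} := by
  refine isInverseSubsemigroup_of_commute ?_ ?_ ?_
  · rintro T ⟨S, D, D', h⟩ T' ⟨S', E, E', h'⟩
    exact ⟨_, h.mul hμ hp2 h'⟩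
  · rintro T ⟨S, D, D', h⟩
    exact ⟨S, ⟨T, D', D, h.symm⟩, h.isGenInverse⟩
  · rintro P ⟨_, _, _, hP⟩ Q ⟨_, _, _, hQ⟩ hPP hQQ
    exact (hP.isMultiplicationOp_of_isIdempotentElem hPP).commute
      (hQ.isMultiplicationOp_of_isIdempotentElem hQQ)

theorem LpPIso_eq_setOf_isChiPair :
    LpPIso 𝕜 (Lp 𝕜 p μ) p = {T | ∃ S D D', IsChiPair T S D D'} := by
  refine Set.ext fun T ↦ ⟨?_, ?_⟩
  · rintro ⟨hT, S, hS, hTS, hleft, hright⟩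
    exact exists_isChiPair_iff.2 ⟨hT, S, hS, hTS, hleft.isMultiplicationOp hμ hp2,
      hright.isMultiplicationOp hμ hp2⟩
  · rintro ⟨S, D, D', h⟩
    exact ⟨h.norm_left_le, S, h.norm_right_le, h.isGenInverse,
      h.mul_left ▸ isLpProjection_chiOp h.measurableSet_left,
      h.mul_right ▸ isLpProjection_chiOp h.measurableSet_right⟩

theorem MPPIso_eq_setOf_isChiPair (hμ0 : μ ≠ 0) :
    MPPIso (Lp ℂ p μ →L[ℂ] Lp ℂ p μ) = {T | ∃ S D D', IsChiPair T S D D'} := by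
  refine Set.ext fun T ↦ ⟨?_, ?_⟩
  · rintro ⟨hT, S, hS, hTS, hleft, hright⟩
    exact exists_isChiPair_iff.2 ⟨hT, S, hS, hTS,
      hleft.isMultiplicationOp hμ hp2 hTS.isIdempotentElem_mul,
      hright.isMultiplicationOp hμ hp2 hTS.symm.isIdempotentElem_mul⟩
  · rintro ⟨S, D, D', h⟩
    exact ⟨h.norm_left_le, S, h.norm_right_le, h.isGenInverse,
      h.mul_left ▸ isHermitianElem_chiOp hμ hμ0 h.measurableSet_left,
      h.mul_right ▸ isHermitianElem_chiOp hμ hμ0 h.measurableSet_right⟩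

end PartialIsometries

end SpatialPI

end

theorem mainTheorem5 {𝕜 : Type*} [RCLike 𝕜] {Ω : Type*} [MeasurableSpace Ω] (μ : Measure Ω)
    (hμ : SpatialPI.IsLocalizable μ) (p : ℝ≥0∞) [Fact (1 ≤ p)] (hp : p ≠ 2) :
    (∀ T : Lp 𝕜 p μ →L[𝕜] Lp 𝕜 p μ,
      T ∈ SpatialPI.SPIso 𝕜 p μ ↔
        ‖T‖ ≤ 1 ∧ ∃ S : Lp 𝕜 p μ →L[𝕜] Lp 𝕜 p μ, ‖S‖ ≤ 1 ∧ SpatialPI.IsGenInverse T S ∧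
          SpatialPI.IsMultiplicationOp (T * S) ∧ SpatialPI.IsMultiplicationOp (S * T)) ∧
    SpatialPI.SPIso 𝕜 p μ = SpatialPI.LpPIso 𝕜 (Lp 𝕜 p μ) p ∧
    SpatialPI.IsInverseSubsemigroup (SpatialPI.LpPIso 𝕜 (Lp 𝕜 p μ) p) ∧
    (μ ≠ 0 → SpatialPI.SPIso ℂ p μ = SpatialPI.MPPIso (Lp ℂ p μ →L[ℂ] Lp ℂ p μ)) := by
  refine ⟨fun T ↦ ?_, ?_, ?_, fun hμ0 ↦ ?_⟩
  · rw [SpatialPI.SPIso_eq_setOf_isChiPair hμ hp]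
    exact SpatialPI.exists_isChiPair_iff
  · rw [SpatialPI.SPIso_eq_setOf_isChiPair hμ hp, SpatialPI.LpPIso_eq_setOf_isChiPair hμ hp]
  · rw [SpatialPI.LpPIso_eq_setOf_isChiPair hμ hp]
    exact SpatialPI.isInverseSubsemigroup_setOf_isChiPair hμ hp
  · rw [SpatialPI.SPIso_eq_setOf_isChiPair hμ hp,
      SpatialPI.MPPIso_eq_setOf_isChiPair hμ hp hμ0]
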